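/- Let $n \ge m \ge 3$ be integers and let $A \in \mathbb{R}^{n\times m}$ be a uniform random matrix, i.e. the rows $a_1,\dots,a_n$ of $A$ are independent random vectors, each uniformly distributed on the unit sphere $S^{m-1}\subset\mathbb{R}^m$. For a real $n\times m$ matrix $A$ with nonzero rows $a_i$ and $x\in\mathbb{R}^m\setminus\{0\}$, let $$\theta(A,x)=\min_{1\le i\le n}\arccos\frac{a_i\cdot x}{\|a_i\|\,\|x\|},\qquad \theta(A)=\sup_{x\in\mathbb{R}^m\setminus\{0\}}\theta(A,x),\qquad \mathscr{C}(A)=|\cos\theta(A)|^{-1}\in[1,\infty].$$ Then $\mathscr{C}(A)<\infty$ almost surely, and for every real $\gamma\ge 1$ the random variable $(\log\mathscr{C}(A))^\gamma$ is integrable with $$\mathbf{E}\left[(\log\mathscr{C}(A))^\gamma\right]\le\left(m\log n+\tfrac52\log m+\log 2\right)^\gamma+\Gamma(\gamma+1)\,2^{\gamma-1},$$ where $\log$ is the natural logarithm. In particular, $\log\mathscr{C}(A)$ is square-integrable and $$\mathbf{E}\left[\log\mathscr{C}(A)\right]\le m\log n+\tfrac52\log m+\log 2+1,$$ $$\mathbf{Var}\left(\log\mathscr{C}(A)\right)\le\left(m\log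 n+\tfrac52\log m+\log 2\right)^2+4.$$ -/

import Mathlib

open MeasureTheory ProbabilityTheory Metric
open scoped ENNReal

noncomputable section

/-- The `i`-th row `a_i` of a real `n × m` matrix, as a vector of Euclidean space `ℝ^m`. -/
def rowVec {n m : ℕ} (A : Matrix (Fin n) (Fin m) ℝ) (i : Fin n) : EuclideanSpace ℝ (Fin m) :=
  WithLp.toLp 2 (A i)

/-- `θ(A, x) = min_i θ_i(A, x)`, where `θ_i(A, x) ∈ [0, π]` is the angle between the `i`-th row
of `A` and `x`. -/
def thetaAt {n m : ℕ} (A : Matrix (Fin n) (Fin m) ℝ) (x : EuclideanSpace ℝ (Fin m)) : ℝ :=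
  ⨅ i : Fin n, InnerProductGeometry.angle (rowVec A i) x

/-- `θ(A) = sup_{x ≠ 0} θ(A, x)`. -/
def theta {n m : ℕ} (A : Matrix (Fin n) (Fin m) ℝ) : ℝ :=
  ⨆ x : {x : EuclideanSpace ℝ (Fin m) // x ≠ 0}, thetaAt A x

/-- The condition number `𝒞(A) = |cos θ(A)|⁻¹ ∈ [1, ∞]`; it is `∞` exactly when `cos θ(A) = 0`. -/
def condNumber {n m : ℕ} (A : Matrix (Fin n) (Fin m) ℝ) : ℝ≥0∞ :=
  (ENNReal.ofReal |Real.cos (theta A)|)⁻¹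

/-- `log 𝒞(A)` as a real number. It is the true value whenever `𝒞(A) < ∞`
(and `0` by convention if `𝒞(A) = ∞`). -/
def logCondNumber {n m : ℕ} (A : Matrix (Fin n) (Fin m) ℝ) : ℝ :=
  Real.log (condNumber A).toReal

/-- The uniform distribution on the unit sphere `S^{m-1}` of `ℝ^m`: the surface measure, divided by
its total mass. -/
def uniformSphere (m : ℕ) : Measure (sphere (0 : EuclideanSpace ℝ (Fin m)) 1) :=
  ((volume : Measure (EuclideanSpace ℝ (Fin m))).toSphere Set.univ)⁻¹ •
    (volume : Measure (EuclideanSpace ℝ (Fin m))).toSphere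

/-- The matrix `[a_1 ⋯ a_n]ᵀ` whose rows are the given unit vectors. -/
def matrixOfRows {n m : ℕ} (a : Fin n → sphere (0 : EuclideanSpace ℝ (Fin m)) 1) :
    Matrix (Fin n) (Fin m) ℝ :=
  Matrix.of fun i j => (a i : EuclideanSpace ℝ (Fin m)) j

/-- `A` is a uniform random `n × m` matrix: its rows are i.i.d. random vectors, uniformly
distributed on the unit sphere `S^{m-1}`. -/
def IsUniformRandomMatrix {Ω : Type*} [MeasurableSpace Ω] (P : Measure Ω) {n m : ℕ}
    (A : Ω → Matrix (Fin n) (Fin m) ℝ) : Prop :=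
  ∃ a : Fin n → Ω → sphere (0 : EuclideanSpace ℝ (Fin m)) 1,
    (∀ i, HasLaw (a i) (uniformSphere m) P) ∧ iIndepFun a P ∧
      ∀ ω, A ω = matrixOfRows fun i => a i ω

end

/-! Everything rests on a tail bound for `|cos θ(A)|` near 0. Write `L = m log n + (5/2) log m + log
2`, so that `exp(L/2)² = 2 m^(5/2) n^m`.

Geometry. Almost surely the rows are in general position. If `|cos θ(A)| < ε`, there is a vector `y`
with `‖y‖ ≥ 1/ε` and `⟪a j, y⟫ ≤ b` for all `j`, where `b = -1` if the system `⟪a j, z⟫ < 0` is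
feasible and `b = 1` if not. Moving `y` without leaving this region until the tight constraints span
yields `m` independent rows on a hyperplane at distance `1/‖y‖ ≤ ε` from the origin, with all rows
on one side (`exists_tight_hyperplane`). Cofactors then show that one of these `m` rows is within
`mε` of the span of the others (`exists_abs_inner_cofactorVec_le`).

Probability. A union bound over the `m`-subsets `I` remains. The band of half-width `s` about a
great subsphere has measure at most `bandBound m s`, by comparison with a Gaussian vector. Given the
rows in `I`, the other `n - m` rows fall independently into a cap of measure about 1/2. This gives
`measure_abs_cos_theta_lt_le`, and `tail_constant_le` bounds its right side by `exp(L/2) ε`.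

Moments. Hence `log 𝒞(A)` exceeds `L/2 + w` with probability at most `exp(-w)`: it is `L/2` plus at
most an exponential variable, and convexity of `t ↦ t^γ` gives the moment bound. -/

open scoped RealInnerProductSpace

/-! ### Vertices of polyhedra and strict feasibility -/

section Polyhedron

variable {ι E : Type*} [NormedAddCommGroup E] [InnerProductSpace ℝ E]

/-- In a set of points satisfying `⟪a j, y⟫ ≤ b`, stable under suitable moves, some point has
tight constraints that span the whole space. -/
theorem exists_span_tight_eq_top [Fintype ι] [FiniteDimensional ℝ E] (a : ι → E) (b : ℝ) (S : Set E)
    (hSb : ∀ y ∈ S, ∀ j, ⟪a j, y⟫ ≤ b)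
    (hmove : ∀ y ∈ S, ∀ v ≠ 0, ∃ v', (v' = v ∨ v' = -v) ∧ (∃ j, 0 < ⟪a j, v'⟫) ∧
      ∀ t : ℝ, 0 ≤ t → (∀ j, ⟪a j, y + t • v'⟫ ≤ b) → y + t • v' ∈ S)
    (hne : S.Nonempty) :
    ∃ y ∈ S, Submodule.span ℝ (a '' {i | ⟪a i, y⟫ = b}) = ⊤ := by
  classical
  by_contra! hcon
  -- If the tight constraints never span, their number can be increased without end, although there
  -- are finitely many.
  have key : ∀ k : ℕ, ∃ y ∈ S, k ≤ (Finset.univ.filter fun i => ⟪a i, y⟫ = b).card := by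
    intro k
    induction k with
    | zero => obtain ⟨y, hy⟩ := hne; exact ⟨y, hy, Nat.zero_le _⟩
    | succ k ih =>
      obtain ⟨y, hy, hk⟩ := ih
      obtain ⟨v, hv, hv0⟩ : ∃ v ∈ (Submodule.span ℝ (a '' {i | ⟪a i, y⟫ = b}))ᗮ, v ≠ 0 := by
        apply Submodule.exists_mem_ne_zero_of_ne_bot
        rw [Ne, Submodule.orthogonal_eq_bot_iff]
        exact hcon y hy
      have hvt : ∀ i, ⟪a i, y⟫ = b → ⟪a i, v⟫ = 0 := fun i hi =>
        (Submodule.mem_orthogonal _ _).1 hv _ (Submodule.subset_span ⟨i, hi, rfl⟩)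
      obtain ⟨v', hv', ⟨j₁, hj₁⟩, hS⟩ := hmove y hy v hv0
      have hvt' : ∀ i, ⟪a i, y⟫ = b → ⟪a i, v'⟫ = 0 := by
        intro i hi
        rcases hv' with rfl | rfl
        · exact hvt i hi
        · rw [inner_neg_right, hvt i hi, neg_zero]
      -- Ratio test: `j₀` is the first constraint reached along `v'`. Being orthogonal to the tight
      -- vectors, `v'` keeps the old constraints tight.
      obtain ⟨j₀, hj₀, hmin⟩ := Finset.exists_min_image
        (Finset.univ.filter fun j => 0 < ⟪a j, v'⟫) (fun j => (b - ⟪a j, y⟫) / ⟪a j, v'⟫)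
        ⟨j₁, by simpa using hj₁⟩
      simp only [Finset.mem_filter, Finset.mem_univ, true_and] at hj₀ hmin
      set t := (b - ⟪a j₀, y⟫) / ⟪a j₀, v'⟫ with ht
      have ht0 : 0 ≤ t := div_nonneg (by linarith [hSb y hy j₀]) hj₀.le
      have hin : y + t • v' ∈ S := by
        refine hS t ht0 fun j => ?_
        rw [inner_add_right, real_inner_smul_right]
        by_cases hj : 0 < ⟪a j, v'⟫
        · have := hmin j hj
          rw [le_div_iff₀ hj] at this
          linarith
        · have := mul_nonneg ht0 (by linarith : 0 ≤ -⟪a j, v'⟫)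
          linarith [hSb y hy j]
      refine ⟨_, hin, (Nat.succ_le_succ hk).trans (Finset.card_lt_card ?_)⟩
      rw [Finset.ssubset_iff_of_subset]
      · refine ⟨j₀, ?_, ?_⟩
        · simp only [Finset.mem_filter, Finset.mem_univ, true_and]
          rw [inner_add_right, real_inner_smul_right, ht]
          field_simp
          ring
        · simp only [Finset.mem_filter, Finset.mem_univ, true_and]
          exact fun h => hj₀.ne' (hvt' _ h)
      · intro i hi
        simp only [Finset.mem_filter, Finset.mem_univ, true_and] at hi ⊢
        rw [inner_add_right, real_inner_smul_right, hvt' i hi, hi]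
        simp
  obtain ⟨y, -, hy⟩ := key (Fintype.card ι + 1)
  exact absurd (hy.trans (Finset.card_le_univ _)) (by simp)

theorem exists_finset_linearIndepOn_of_span_eq_top [Fintype ι] [FiniteDimensional ℝ E]
    (a : ι → E) (T : Set ι) (hT : Submodule.span ℝ (a '' T) = ⊤) :
    ∃ I : Finset ι, ↑I ⊆ T ∧ LinearIndepOn ℝ a I ∧ I.card = Module.finrank ℝ E := by
  classical
  obtain ⟨b, hbT, -, hspan, hb⟩ := exists_linearIndepOn_extension
    (linearIndepOn_empty ℝ a) (Set.empty_subset T)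
  have htop : Submodule.span ℝ (a '' b) = ⊤ := by
    rw [eq_top_iff, ← hT]
    exact Submodule.span_le.2 hspan
  refine ⟨b.toFinset, by simpa using hbT, by simpa using hb, ?_⟩
  rw [Set.toFinset_card]
  have h2 : Submodule.span ℝ (Set.range fun x : b => a x) = ⊤ := by
    rw [← htop]; congr 1; ext; simp
  exact (Module.finrank_eq_card_basis (Module.Basis.mk hb h2.ge)).symm

/-- Every subfamily of at most `dim E` vectors is linearly independent. -/
def GeneralPosition (a : ι → E) : Prop :=
  ∀ J : Finset ι, J.card ≤ Module.finrank ℝ E → LinearIndepOn ℝ a J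

theorem GeneralPosition.span_eq_top [FiniteDimensional ℝ E] {a : ι → E} (ha : GeneralPosition a)
    {T : Finset ι} (hT : Module.finrank ℝ E ≤ T.card) :
    Submodule.span ℝ (a '' (T : Set ι)) = ⊤ := by
  classical
  obtain ⟨J, hJT, hJ⟩ := Finset.exists_subset_card_eq hT
  have h := ha J hJ.le
  have h1 := LinearIndependent.span_eq_top_of_card_eq_finrank' h (by simpa using hJ)
  rw [eq_top_iff, ← h1]
  refine Submodule.span_mono ?_
  rintro _ ⟨x, rfl⟩
  exact ⟨x, hJT x.2, rfl⟩

theorem exists_inner_eq_of_linearIndepOn [FiniteDimensional ℝ E] {a : ι → E} {T : Set ι}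
    (hT : LinearIndepOn ℝ a T) (b : ℝ) : ∃ z : E, ∀ i ∈ T, ⟪a i, z⟫ = b := by
  let f := (Module.Basis.span hT).constr ℝ (fun _ => b)
  obtain ⟨g, hg⟩ := f.exists_extend
  refine ⟨(InnerProductSpace.toDual ℝ E).symm (LinearMap.toContinuousLinearMap g), fun i hi => ?_⟩
  rw [real_inner_comm, InnerProductSpace.toDual_symm_apply]
  have h1 : ((Module.Basis.span hT ⟨i, hi⟩ : Submodule.span ℝ _) : E) = a i :=
    congrArg Subtype.val (Module.Basis.span_apply hT ⟨i, hi⟩)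
  have h2 := congrArg (fun F => F (Module.Basis.span hT ⟨i, hi⟩)) hg
  simp only [LinearMap.comp_apply, Submodule.subtype_apply, h1] at h2
  rw [LinearMap.coe_toContinuousLinearMap', h2]
  simp [f, Module.Basis.constr_basis]

/-- In general position, a weakly feasible homogeneous system is strictly feasible. -/
theorem GeneralPosition.exists_forall_inner_neg [Fintype ι] [FiniteDimensional ℝ E] {a : ι → E}
    (ha : GeneralPosition a) {x : E} (hx : x ≠ 0) (hax : ∀ j, ⟪a j, x⟫ ≤ 0) :
    ∃ z : E, ∀ j, ⟪a j, z⟫ < 0 := by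
  classical
  let T := Finset.univ.filter fun j => ⟪a j, x⟫ = 0
  have hTc : T.card < Module.finrank ℝ E := by
    by_contra! h
    have htop := ha.span_eq_top h
    apply hx
    have : x ∈ (Submodule.span ℝ (a '' (T : Set ι)))ᗮ := by
      rw [Submodule.mem_orthogonal]
      intro u hu
      induction hu using Submodule.span_induction with
      | mem u hu => obtain ⟨i, hi, rfl⟩ := hu; simpa [T] using hi
      | zero => simp
      | add u w _ _ hu hw => rw [inner_add_left, hu, hw, add_zero]
      | smul c u _ hu => rw [real_inner_smul_left, hu, mul_zero]
    rwa [htop, Submodule.top_orthogonal_eq_bot, Submodule.mem_bot] at this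
  -- Fewer than `dim E` constraints vanish at `x`, so they are independent and one `z` makes them
  -- all negative. A small step from `x` along `z` keeps the others negative.
  obtain ⟨z, hz⟩ := exists_inner_eq_of_linearIndepOn (ha T hTc.le) (-1)
  have hev : ∀ j, ∀ᶠ t : ℝ in nhdsWithin 0 (Set.Ioi 0), ⟪a j, x + t • z⟫ < 0 := by
    intro j
    by_cases hj : ⟪a j, x⟫ = 0
    · filter_upwards [self_mem_nhdsWithin] with t ht
      rw [inner_add_right, real_inner_smul_right, hj, hz j (by simpa [T] using hj)]
      have : (0 : ℝ) < t := ht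
      linarith
    · have hlt : ⟪a j, x⟫ < 0 := lt_of_le_of_ne (hax j) hj
      have hc : Continuous fun t : ℝ => ⟪a j, x + t • z⟫ := by fun_prop
      have := hc.tendsto 0
      simp only [zero_smul, add_zero] at this
      exact nhdsWithin_le_nhds (this.eventually (gt_mem_nhds hlt))
  obtain ⟨t, ht⟩ := (Filter.eventually_all.2 hev).exists
  exact ⟨_, ht⟩

end Polyhedron

/-! ### From a small cosine to a nearby supporting hyperplane -/

section Theta

variable {n m : ℕ}

@[simp]
theorem rowVec_matrixOfRows (a : Fin n → sphere (0 : EuclideanSpace ℝ (Fin m)) 1) (i : Fin n) :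
    rowVec (matrixOfRows a) i = a i := rfl

theorem thetaAt_nonneg (A : Matrix (Fin n) (Fin m) ℝ) (x : EuclideanSpace ℝ (Fin m)) :
    0 ≤ thetaAt A x :=
  Real.iInf_nonneg fun _ => InnerProductGeometry.angle_nonneg _ _

theorem thetaAt_le_angle (A : Matrix (Fin n) (Fin m) ℝ) (x : EuclideanSpace ℝ (Fin m))
    (i : Fin n) : thetaAt A x ≤ InnerProductGeometry.angle (rowVec A i) x :=
  ciInf_le ⟨0, by rintro _ ⟨i, rfl⟩; exact InnerProductGeometry.angle_nonneg _ _⟩ i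

theorem thetaAt_le_pi (A : Matrix (Fin n) (Fin m) ℝ) (x : EuclideanSpace ℝ (Fin m)) :
    thetaAt A x ≤ Real.pi := by
  rcases isEmpty_or_nonempty (Fin n) with h | ⟨⟨i⟩⟩
  · rw [thetaAt, Real.iInf_of_isEmpty]
    exact Real.pi_pos.le
  · exact (thetaAt_le_angle A x i).trans (InnerProductGeometry.angle_le_pi _ _)

theorem bddAbove_range_thetaAt (A : Matrix (Fin n) (Fin m) ℝ) :
    BddAbove (Set.range fun x : {x : EuclideanSpace ℝ (Fin m) // x ≠ 0} => thetaAt A x) :=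
  ⟨Real.pi, by rintro _ ⟨x, rfl⟩; exact thetaAt_le_pi A x⟩

theorem thetaAt_le_theta (A : Matrix (Fin n) (Fin m) ℝ) {x : EuclideanSpace ℝ (Fin m)}
    (hx : x ≠ 0) : thetaAt A x ≤ theta A :=
  le_ciSup (bddAbove_range_thetaAt A) ⟨x, hx⟩

theorem theta_nonneg (A : Matrix (Fin n) (Fin m) ℝ) : 0 ≤ theta A :=
  Real.iSup_nonneg fun x => thetaAt_nonneg A x

theorem theta_le_pi (A : Matrix (Fin n) (Fin m) ℝ) : theta A ≤ Real.pi :=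
  Real.iSup_le (fun x => thetaAt_le_pi A x) Real.pi_pos.le

variable (a : Fin n → sphere (0 : EuclideanSpace ℝ (Fin m)) 1)

theorem exists_forall_inner_lt_of_cos_theta_lt [NeZero m] {ε : ℝ} (hε1 : ε ≤ 1)
    (h : Real.cos (theta (matrixOfRows a)) < ε) :
    ∃ x : EuclideanSpace ℝ (Fin m), x ≠ 0 ∧
      ∀ j, ⟪(a j : EuclideanSpace ℝ (Fin m)), x⟫ < ε * ‖x‖ := by
  have hlt : Real.arccos ε < theta (matrixOfRows a) := by
    rw [← Real.arccos_cos (theta_nonneg (matrixOfRows a)) (theta_le_pi _)]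
    exact Real.arccos_lt_arccos (Real.neg_one_le_cos _) h hε1
  have : Nonempty {x : EuclideanSpace ℝ (Fin m) // x ≠ 0} := by
    obtain ⟨x, hx⟩ := exists_ne (0 : EuclideanSpace ℝ (Fin m))
    exact ⟨⟨x, hx⟩⟩
  obtain ⟨⟨x, hx⟩, hlt'⟩ := exists_lt_of_lt_ciSup hlt
  refine ⟨x, hx, fun j => ?_⟩
  by_contra! hj
  have h1 := hlt'.trans_le (thetaAt_le_angle _ x j)
  refine absurd h1 (not_lt.2 ?_)
  rw [InnerProductGeometry.angle, rowVec_matrixOfRows]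
  refine Real.arccos_le_arccos ?_
  have hxp : 0 < ‖x‖ := norm_pos_iff.2 hx
  rw [norm_eq_of_mem_sphere, one_mul, le_div_iff₀ hxp]
  exact hj

/-- Use `y` itself as test direction: its angle with each row is at least `arccos (-1 / ‖y‖)`, which
forces `cos θ ≤ -1 / ‖y‖`. -/
theorem one_div_le_norm_of_forall_inner_le [NeZero n] {ε : ℝ} (hε : 0 < ε)
    (h : |Real.cos (theta (matrixOfRows a))| < ε) {y : EuclideanSpace ℝ (Fin m)}
    (hy : ∀ j, ⟪(a j : EuclideanSpace ℝ (Fin m)), y⟫ ≤ -1) : 1 / ε ≤ ‖y‖ := by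
  have hy0 : y ≠ 0 := by
    rintro rfl
    have := hy 0
    simp at this
    linarith
  have hyp : 0 < ‖y‖ := norm_pos_iff.2 hy0
  have h1 : Real.arccos (-1 / ‖y‖) ≤ theta (matrixOfRows a) := by
    refine le_trans ?_ (thetaAt_le_theta _ hy0)
    refine le_ciInf fun j => Real.arccos_le_arccos ?_
    rw [rowVec_matrixOfRows, norm_eq_of_mem_sphere, one_mul]
    gcongr
    exact hy j
  have hy1 : 1 ≤ ‖y‖ := by
    have h2 := abs_real_inner_le_norm (a 0 : EuclideanSpace ℝ (Fin m)) y
    rw [norm_eq_of_mem_sphere, one_mul] at h2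
    linarith [neg_abs_le ⟪(a 0 : EuclideanSpace ℝ (Fin m)), y⟫, hy 0]
  have h3 : -1 ≤ -1 / ‖y‖ := by
    rw [le_div_iff₀ hyp]; linarith
  have h4 : -1 / ‖y‖ ≤ 0 := div_nonpos_of_nonpos_of_nonneg (by norm_num) hyp.le
  have h2 : Real.cos (theta (matrixOfRows a)) ≤ -1 / ‖y‖ := by
    rw [← Real.cos_arccos h3 (by linarith)]
    exact Real.cos_le_cos_of_nonneg_of_le_pi (Real.arccos_nonneg _) (theta_le_pi _) h1
  have h5 : 1 / ‖y‖ < ε := by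
    have := neg_abs_le (Real.cos (theta (matrixOfRows a)))
    rw [neg_div] at h2
    linarith
  rw [div_lt_iff₀ hyp] at h5
  rw [div_le_iff₀ hε]
  linarith

/-- If `|cos θ| < ε` then some `m` rows lie on a hyperplane at distance at most `ε` from the
origin, with all the rows on one side of it. -/
theorem exists_tight_hyperplane [NeZero n] [NeZero m] (hmn : m ≤ n)
    (ha : GeneralPosition fun i => (a i : EuclideanSpace ℝ (Fin m))) {ε : ℝ} (hε : 0 < ε)
    (hε1 : ε ≤ 1) (h : |Real.cos (theta (matrixOfRows a))| < ε) :
    ∃ b : ℝ, (b = 1 ∨ b = -1) ∧ ∃ I : Finset (Fin n), I.card = m ∧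
      LinearIndepOn ℝ (fun i => (a i : EuclideanSpace ℝ (Fin m))) I ∧
      ∃ y : EuclideanSpace ℝ (Fin m), 1 / ε ≤ ‖y‖ ∧
        (∀ i ∈ I, ⟪(a i : EuclideanSpace ℝ (Fin m)), y⟫ = b) ∧
        ∀ j, ⟪(a j : EuclideanSpace ℝ (Fin m)), y⟫ ≤ b := by
  suffices H : ∃ b : ℝ, (b = 1 ∨ b = -1) ∧ ∃ S : Set (EuclideanSpace ℝ (Fin m)),
      (∀ y ∈ S, 1 / ε ≤ ‖y‖ ∧ ∀ j, ⟪(a j : EuclideanSpace ℝ (Fin m)), y⟫ ≤ b) ∧ S.Nonempty ∧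
      (∀ y ∈ S, ∀ v ≠ 0, ∃ v', (v' = v ∨ v' = -v) ∧
        (∃ j, 0 < ⟪(a j : EuclideanSpace ℝ (Fin m)), v'⟫) ∧
        ∀ t : ℝ, 0 ≤ t → (∀ j, ⟪(a j : EuclideanSpace ℝ (Fin m)), y + t • v'⟫ ≤ b) →
          y + t • v' ∈ S) by
    obtain ⟨b, hb, S, hS, hne, hmove⟩ := H
    obtain ⟨y, hyS, hy⟩ := exists_span_tight_eq_top
      (fun i => (a i : EuclideanSpace ℝ (Fin m))) b S (fun y hy => (hS y hy).2) hmove hne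
    obtain ⟨I, hIT, hI, hIc⟩ := exists_finset_linearIndepOn_of_span_eq_top _ _ hy
    exact ⟨b, hb, I, by simpa using hIc, hI, y, (hS y hyS).1, fun i hi => hIT hi, (hS y hyS).2⟩
  -- In the feasible case every point of the polyhedron has norm at least `1/ε`, so the norm imposes
  -- no restriction on the moves.
  by_cases hf : ∃ z : EuclideanSpace ℝ (Fin m), ∀ j, ⟪(a j : EuclideanSpace ℝ (Fin m)), z⟫ < 0
  · obtain ⟨z, hz⟩ := hf
    refine ⟨-1, Or.inr rfl, {y | ∀ j, ⟪(a j : EuclideanSpace ℝ (Fin m)), y⟫ ≤ -1},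
      fun y hy => ⟨one_div_le_norm_of_forall_inner_le a hε h hy, hy⟩, ?_, ?_⟩
    · obtain ⟨j₀, hj₀⟩ := Finite.exists_max fun j => ⟪(a j : EuclideanSpace ℝ (Fin m)), z⟫
      refine ⟨(-⟪(a j₀ : EuclideanSpace ℝ (Fin m)), z⟫)⁻¹ • z, fun j => ?_⟩
      have hp : 0 < -⟪(a j₀ : EuclideanSpace ℝ (Fin m)), z⟫ := by linarith [hz j₀]
      rw [real_inner_smul_right, inv_mul_le_iff₀ hp]
      linarith [hj₀ j]
    · intro y hy v hv
      obtain ⟨j, hj⟩ : ∃ j, ⟪(a j : EuclideanSpace ℝ (Fin m)), v⟫ ≠ 0 := by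
        by_contra! hall
        obtain ⟨w, hw⟩ := ha.exists_forall_inner_neg hv fun j => (hall j).le
        have htop := ha.span_eq_top (T := Finset.univ) (by simpa using hmn)
        apply hv
        have : v ∈ (⊤ : Submodule ℝ (EuclideanSpace ℝ (Fin m)))ᗮ := by
          rw [← htop, Submodule.mem_orthogonal]
          intro u hu
          induction hu using Submodule.span_induction with
          | mem u hu => obtain ⟨i, -, rfl⟩ := hu; exact hall i
          | zero => simp
          | add u w _ _ hu hw => rw [inner_add_left, hu, hw, add_zero]
          | smul c u _ hu => rw [real_inner_smul_left, hu, mul_zero]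
        rwa [Submodule.top_orthogonal_eq_bot, Submodule.mem_bot] at this
      rcases hj.lt_or_gt with hj | hj
      · exact ⟨-v, Or.inr rfl, ⟨j, by rw [inner_neg_right]; linarith⟩, fun t _ ht => ht⟩
      · exact ⟨v, Or.inl rfl, ⟨j, hj⟩, fun t _ ht => ht⟩
  · have hpos : ∀ x : EuclideanSpace ℝ (Fin m), x ≠ 0 →
        ∃ j, 0 < ⟪(a j : EuclideanSpace ℝ (Fin m)), x⟫ := by
      intro x hx
      by_contra! hall
      exact hf (ha.exists_forall_inner_neg hx hall)
    refine ⟨1, Or.inl rfl,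
      {y | 1 / ε ≤ ‖y‖ ∧ ∀ j, ⟪(a j : EuclideanSpace ℝ (Fin m)), y⟫ ≤ 1}, fun y hy => hy, ?_, ?_⟩
    · obtain ⟨x, hx, hlt⟩ := exists_forall_inner_lt_of_cos_theta_lt a hε1 (lt_of_abs_lt h)
      have hxp : 0 < ‖x‖ := norm_pos_iff.2 hx
      refine ⟨(ε * ‖x‖)⁻¹ • x, ?_, fun j => ?_⟩
      · rw [norm_smul, Real.norm_of_nonneg (by positivity)]
        apply le_of_eq
        field_simp
      · rw [real_inner_smul_right, inv_mul_le_iff₀ (by positivity)]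
        linarith [hlt j]
    · intro y hy v hv
      -- With this sign the norm cannot decrease along the move, which preserves `1/ε ≤ ‖y‖`.
      obtain ⟨v', hv', hyv⟩ : ∃ v', (v' = v ∨ v' = -v) ∧ 0 ≤ ⟪y, v'⟫ := by
        rcases le_total 0 ⟪y, v⟫ with hyv | hyv
        · exact ⟨v, Or.inl rfl, hyv⟩
        · exact ⟨-v, Or.inr rfl, by rw [inner_neg_right]; linarith⟩
      refine ⟨v', hv', hpos v' ?_, fun t ht hall => ⟨hy.1.trans ?_, hall⟩⟩
      · rcases hv' with rfl | rfl
        · exact hv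
        · exact neg_ne_zero.2 hv
      · refine le_of_sq_le_sq ?_ (norm_nonneg _)
        rw [norm_add_sq_real, real_inner_smul_right]
        have := mul_nonneg ht hyv
        nlinarith [sq_nonneg ‖t • v'‖]

end Theta

/-! ### Cofactors and hyperplane normals -/

section Cofactor

variable {m : ℕ}

/-- The square matrix with the given rows. -/
def rowMatrix (r : Fin m → EuclideanSpace ℝ (Fin m)) : Matrix (Fin m) (Fin m) ℝ :=
  Matrix.of fun i k => r i k

/-- The vector of cofactors of the `i`-th row; it is orthogonal to all the other rows. -/
def cofactorVec (r : Fin m → EuclideanSpace ℝ (Fin m)) (i : Fin m) : EuclideanSpace ℝ (Fin m) :=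
  WithLp.toLp 2 fun k => (rowMatrix r).adjugate k i

/-- A normal vector of the affine hyperplane through the given vectors. -/
def hyperplaneNormal (r : Fin m → EuclideanSpace ℝ (Fin m)) : EuclideanSpace ℝ (Fin m) :=
  (rowMatrix r).det • ∑ i, cofactorVec r i

theorem inner_cofactorVec (r : Fin m → EuclideanSpace ℝ (Fin m)) (k i : Fin m) :
    ⟪r k, cofactorVec r i⟫ = if k = i then (rowMatrix r).det else 0 := by
  have h := congrFun (congrFun (Matrix.mul_adjugate (rowMatrix r)) k) i
  rw [Matrix.smul_apply, Matrix.one_apply, smul_eq_mul, mul_ite, mul_one, mul_zero] at h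
  rw [← h, Matrix.mul_apply, PiLp.inner_apply]
  exact Finset.sum_congr rfl fun j _ => by
    simp [cofactorVec, rowMatrix, mul_comm]

/-- The cofactors of a row do not involve that row. This makes the `i`-th row independent of its own
cofactor vector when rows are random. -/
theorem cofactorVec_congr {r r' : Fin m → EuclideanSpace ℝ (Fin m)} {i : Fin m}
    (h : ∀ k, k ≠ i → r k = r' k) : cofactorVec r i = cofactorVec r' i := by
  unfold cofactorVec
  congr 1
  ext k
  rw [Matrix.adjugate_apply, Matrix.adjugate_apply]
  congr 1
  ext p q
  by_cases hp : p = i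
  · subst hp; simp
  · simp [Matrix.updateRow_ne hp, rowMatrix, h p hp]

theorem continuous_rowMatrix :
    Continuous (rowMatrix : (Fin m → EuclideanSpace ℝ (Fin m)) → _) := by
  unfold rowMatrix
  refine continuous_matrix fun i k => ?_
  simp only [Matrix.of_apply]
  fun_prop

theorem continuous_cofactorVec (i : Fin m) :
    Continuous fun r : Fin m → EuclideanSpace ℝ (Fin m) => cofactorVec r i := by
  unfold cofactorVec
  refine (PiLp.continuous_toLp 2 _).comp (continuous_pi fun k => ?_)
  exact (continuous_rowMatrix.matrix_adjugate).matrix_elem k i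

theorem continuous_hyperplaneNormal :
    Continuous (hyperplaneNormal : (Fin m → EuclideanSpace ℝ (Fin m)) → _) := by
  unfold hyperplaneNormal
  exact continuous_rowMatrix.matrix_det.smul
    (continuous_finsetSum _ fun i _ => continuous_cofactorVec i)

theorem det_rowMatrix_ne_zero {r : Fin m → EuclideanSpace ℝ (Fin m)}
    (hr : LinearIndependent ℝ r) : (rowMatrix r).det ≠ 0 := by
  have h : LinearIndependent ℝ (rowMatrix r).row :=
    hr.map' (WithLp.linearEquiv 2 ℝ (Fin m → ℝ)).toLinearMap (LinearEquiv.ker _)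
  rw [Matrix.linearIndependent_rows_iff_isUnit, Matrix.isUnit_iff_isUnit_det] at h
  exact h.ne_zero

theorem cofactorVec_ne_zero {r : Fin m → EuclideanSpace ℝ (Fin m)}
    (hr : LinearIndependent ℝ r) (i : Fin m) : cofactorVec r i ≠ 0 := by
  intro h
  have := inner_cofactorVec r i i
  rw [h, inner_zero_right, if_pos rfl] at this
  exact det_rowMatrix_ne_zero hr this.symm

/-- The extra factor `det` in `hyperplaneNormal` produces a square here, which fixes the orientation
of the normal. -/
theorem inner_hyperplaneNormal (r : Fin m → EuclideanSpace ℝ (Fin m)) (k : Fin m) :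
    ⟪r k, hyperplaneNormal r⟫ = (rowMatrix r).det ^ 2 := by
  rw [hyperplaneNormal, real_inner_smul_right, inner_sum]
  simp [inner_cofactorVec, sq]

theorem hyperplaneNormal_ne_zero [NeZero m] {r : Fin m → EuclideanSpace ℝ (Fin m)}
    (hr : LinearIndependent ℝ r) : hyperplaneNormal r ≠ 0 := by
  intro h
  have := inner_hyperplaneNormal r 0
  rw [h, inner_zero_right] at this
  exact pow_ne_zero 2 (det_rowMatrix_ne_zero hr) this.symm

theorem hyperplaneNormal_eq {r : Fin m → EuclideanSpace ℝ (Fin m)}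
    (hr : LinearIndependent ℝ r) {b : ℝ} {y : EuclideanSpace ℝ (Fin m)}
    (hy : ∀ i, ⟪r i, y⟫ = b) : b • hyperplaneNormal r = (rowMatrix r).det ^ 2 • y := by
  have hspan : Submodule.span ℝ (Set.range r) = ⊤ :=
    hr.span_eq_top_of_card_eq_finrank' (by simp)
  rw [← sub_eq_zero, ← Submodule.mem_bot ℝ, ← Submodule.top_orthogonal_eq_bot, ← hspan,
    Submodule.mem_orthogonal]
  intro u hu
  induction hu using Submodule.span_induction with
  | mem u hu =>
    obtain ⟨i, rfl⟩ := hu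
    rw [inner_sub_right, real_inner_smul_right, real_inner_smul_right, hy, inner_hyperplaneNormal]
    ring
  | zero => simp
  | add u w _ _ hu hw => rw [inner_add_left, hu, hw, add_zero]
  | smul c u _ hu => rw [real_inner_smul_left, hu, mul_zero]

/-- The cofactor vectors sum to a vector of norm `|det| ‖y‖ ≥ |det| / ε`, so one of the `m` has norm
at least `|det| / (m ε)`; and `|det|` is the inner product of its row with it. -/
theorem exists_abs_inner_cofactorVec_le [NeZero m] {r : Fin m → EuclideanSpace ℝ (Fin m)}
    (hr : LinearIndependent ℝ r) {b : ℝ} (hb : b = 1 ∨ b = -1) {y : EuclideanSpace ℝ (Fin m)}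
    (hy : ∀ i, ⟪r i, y⟫ = b) {ε : ℝ} (hε : 0 < ε) (hyn : 1 / ε ≤ ‖y‖) :
    ∃ i, |⟪r i, cofactorVec r i⟫| ≤ m * ε * ‖cofactorVec r i‖ := by
  by_contra! hcon
  have hd : 0 < |(rowMatrix r).det| := abs_pos.2 (det_rowMatrix_ne_zero hr)
  have h1 := congrArg norm (hyperplaneNormal_eq hr hy)
  have hbn : ‖b‖ = 1 := by rcases hb with rfl | rfl <;> simp
  rw [norm_smul, norm_smul, hbn, one_mul, hyperplaneNormal, norm_smul, norm_pow,
    Real.norm_eq_abs, sq, mul_assoc] at h1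
  have h2 := mul_left_cancel₀ hd.ne' h1
  have h3 : m * ε * ‖∑ i, cofactorVec r i‖ < m * |(rowMatrix r).det| := by
    calc m * ε * ‖∑ i, cofactorVec r i‖ ≤ m * ε * ∑ i, ‖cofactorVec r i‖ := by
          gcongr; exact norm_sum_le _ _
      _ = ∑ i, m * ε * ‖cofactorVec r i‖ := Finset.mul_sum _ _ _
      _ < ∑ _i : Fin m, |(rowMatrix r).det| := by
          refine Finset.sum_lt_sum_of_nonempty ⟨0, Finset.mem_univ _⟩ fun i _ => ?_
          have := hcon i
          rwa [inner_cofactorVec, if_pos rfl] at this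
      _ = _ := by simp
  have hm : (0 : ℝ) < m := by exact_mod_cast Nat.pos_of_ne_zero (NeZero.ne m)
  rw [mul_assoc] at h3
  have h4 := lt_of_mul_lt_mul_left h3 hm.le
  rw [h2] at h4
  have h5 : 1 ≤ ε * ‖y‖ := by
    rw [div_le_iff₀ hε] at hyn; linarith
  nlinarith

theorem inner_hyperplaneNormal_le {r : Fin m → EuclideanSpace ℝ (Fin m)}
    (hr : LinearIndependent ℝ r) {b : ℝ} (hb : b = 1 ∨ b = -1) {y : EuclideanSpace ℝ (Fin m)}
    (hy : ∀ i, ⟪r i, y⟫ = b) {ε : ℝ} (hε : 0 < ε) (hyn : 1 / ε ≤ ‖y‖)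
    {x : EuclideanSpace ℝ (Fin m)} (hx : ⟪x, y⟫ ≤ b) :
    ⟪x, b • hyperplaneNormal r⟫ ≤ max 0 (b * ε) * ‖b • hyperplaneNormal r‖ := by
  rw [hyperplaneNormal_eq hr hy, norm_smul, real_inner_smul_right, norm_pow,
    Real.norm_eq_abs, sq_abs]
  have hd : 0 ≤ (rowMatrix r).det ^ 2 := sq_nonneg _
  have h5 : 1 ≤ ε * ‖y‖ := by
    rw [div_le_iff₀ hε] at hyn; linarith
  have h6 : ⟪x, y⟫ ≤ max 0 (b * ε) * ‖y‖ := by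
    rcases hb with rfl | rfl
    · rw [one_mul, max_eq_right hε.le]; linarith
    · rw [max_eq_left (by linarith)]; linarith
  calc _ ≤ (rowMatrix r).det ^ 2 * (max 0 (b * ε) * ‖y‖) := by gcongr
    _ = _ := by ring

end Cofactor

/-! ### Uniform directions from the standard Gaussian -/

section Gaussian

variable {m : ℕ}

theorem stdGaussian_eq_withDensity (E : Type*) [NormedAddCommGroup E] [InnerProductSpace ℝ E]
    [FiniteDimensional ℝ E] [MeasurableSpace E] [BorelSpace E] :
    stdGaussian E = (volume : Measure E).withDensity fun x =>
      ENNReal.ofReal (((Real.pi / (1 / 2)) ^ (Module.finrank ℝ E / 2 : ℝ))⁻¹ *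
        Real.exp (-(1 / 2) * ‖x‖ ^ 2)) := by
  set K : ℝ := (Real.pi / (1 / 2)) ^ (Module.finrank ℝ E / 2 : ℝ) with hK
  have hKpos : 0 < K := by positivity
  have hint : Integrable (fun x : E => Real.exp (-(1 / 2) * ‖x‖ ^ 2)) := by
    have h := GaussianFourier.integrable_cexp_neg_mul_sq_norm_add (b := 1 / 2) (by norm_num) 0
      (0 : E)
    refine h.norm.congr (Filter.Eventually.of_forall fun x => ?_)
    simp only [Complex.norm_exp]
    congr 1
    simp [← Complex.ofReal_pow]
  have hfin : IsFiniteMeasure ((volume : Measure E).withDensity fun x =>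
      ENNReal.ofReal (K⁻¹ * Real.exp (-(1 / 2) * ‖x‖ ^ 2))) :=
    isFiniteMeasure_withDensity_ofReal (hint.const_mul _).2
  refine Measure.ext_of_charFun (funext fun t => ?_)
  rw [charFun_stdGaussian, charFun_apply, integral_withDensity_eq_integral_toReal_smul
    (by fun_prop) (by simp)]
  have h1 : ∀ x : E, (ENNReal.ofReal (K⁻¹ * Real.exp (-(1 / 2) * ‖x‖ ^ 2))).toReal •
      Complex.exp (⟪x, t⟫ * Complex.I) =
      (K : ℂ)⁻¹ * Complex.exp (-(1 / 2 : ℂ) * ‖x‖ ^ 2 + Complex.I * ⟪t, x⟫) := by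
    intro x
    rw [ENNReal.toReal_ofReal (by positivity), Complex.real_smul, Complex.exp_add,
      real_inner_comm, mul_comm Complex.I]
    push_cast
    ring
  simp_rw [h1]
  rw [integral_const_mul, GaussianFourier.integral_cexp_neg_mul_sq_norm_add (by norm_num)]
  have hKc : (K : ℂ) = ((Real.pi : ℂ) / (1 / 2)) ^ (Module.finrank ℝ E / 2 : ℂ) := by
    rw [hK, Complex.ofReal_cpow (by positivity)]
    push_cast
    rfl
  rw [← hKc, ← mul_assoc, inv_mul_cancel₀ (by exact_mod_cast hKpos.ne'), one_mul, Complex.I_sq]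
  congr 1
  ring

instance [NeZero m] : IsProbabilityMeasure (uniformSphere m) := by
  constructor
  rw [uniformSphere, Measure.smul_apply, smul_eq_mul]
  exact ENNReal.inv_mul_cancel
    (by rw [Ne, Measure.measure_univ_eq_zero]; exact Measure.toSphere_ne_zero _)
    (measure_ne_top _ _)

/-- The directional distribution of a rotationally invariant density is uniform. -/
theorem uniformSphere_preimage_cone [NeZero m] (f : ℝ → ℝ≥0∞) (hf : Measurable f)
    (hprob : IsProbabilityMeasure
      ((volume : Measure (EuclideanSpace ℝ (Fin m))).withDensity fun x => f ‖x‖))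
    {T : Set (EuclideanSpace ℝ (Fin m))} (hT : MeasurableSet T)
    (hcone : ∀ r : ℝ, 0 < r → ∀ x, r • x ∈ T ↔ x ∈ T) :
    uniformSphere m {a | (a : EuclideanSpace ℝ (Fin m)) ∈ T} =
      ((volume : Measure (EuclideanSpace ℝ (Fin m))).withDensity fun x => f ‖x‖) T := by
  -- In polar coordinates the mass of a cone is its angular measure times a radial integral not
  -- depending on the cone. Taking the whole space identifies that integral as the inverse of the
  -- total surface measure.
  have key : ∀ T : Set (EuclideanSpace ℝ (Fin m)), MeasurableSet T →
      (∀ r : ℝ, 0 < r → ∀ x, r • x ∈ T ↔ x ∈ T) →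
      ((volume : Measure (EuclideanSpace ℝ (Fin m))).withDensity fun x => f ‖x‖) T =
      (volume : Measure (EuclideanSpace ℝ (Fin m))).toSphere
        {a | (a : EuclideanSpace ℝ (Fin m)) ∈ T} * ∫⁻ r : Set.Ioi (0 : ℝ), f r
          ∂Measure.volumeIoiPow (Module.finrank ℝ (EuclideanSpace ℝ (Fin m)) - 1) := by
    intro T hT hcone
    have hT' : MeasurableSet
        {a : sphere (0 : EuclideanSpace ℝ (Fin m)) 1 | (a : EuclideanSpace ℝ (Fin m)) ∈ T} :=
      measurable_subtype_coe hT
    have hL : ∫⁻ x, T.indicator (fun x => f ‖x‖) x =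
        ∫⁻ x : ({0}ᶜ : Set (EuclideanSpace ℝ (Fin m))), T.indicator (fun x => f ‖x‖) x
          ∂Measure.comap Subtype.val volume := by
      rw [lintegral_subtype_comap (measurableSet_singleton _).compl, restrict_compl_singleton]
    have hmp :=
      (volume : Measure (EuclideanSpace ℝ (Fin m))).measurePreserving_homeomorphUnitSphereProd
    rw [withDensity_apply _ hT, ← lintegral_indicator hT, hL, ← lintegral_indicator_one hT',
      ← lintegral_prod_mul (g := fun r : Set.Ioi (0 : ℝ) => f r)
      ((measurable_one.indicator hT').aemeasurable)
      (hf.comp measurable_subtype_coe).aemeasurable,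
      ← hmp.lintegral_comp (by
        refine ((measurable_one.indicator hT').comp measurable_fst).mul
          ((hf.comp measurable_subtype_coe).comp measurable_snd))]
    refine lintegral_congr fun x => ?_
    have hx : 0 < ‖(x : EuclideanSpace ℝ (Fin m))‖ := norm_pos_iff.2 x.2
    have h1 : (homeomorphUnitSphereProd _ x).1 ∈
        {a : sphere (0 : EuclideanSpace ℝ (Fin m)) 1 | (a : EuclideanSpace ℝ (Fin m)) ∈ T} ↔
        (x : EuclideanSpace ℝ (Fin m)) ∈ T := by
      rw [Set.mem_ofPred_eq, homeomorphUnitSphereProd_apply_fst_coe]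
      exact hcone _ (inv_pos.2 hx) _
    by_cases hxT : (x : EuclideanSpace ℝ (Fin m)) ∈ T
    · rw [Set.indicator_of_mem hxT, Set.indicator_of_mem (h1.2 hxT)]
      simp
    · rw [Set.indicator_of_notMem hxT, Set.indicator_of_notMem (fun h => hxT (h1.1 h))]
      simp
  have h1 := key Set.univ MeasurableSet.univ (by simp)
  rw [measure_univ] at h1
  simp only [Set.mem_univ, Set.ofPred_true] at h1
  rw [key T hT hcone, uniformSphere, Measure.smul_apply, smul_eq_mul, mul_comm]
  congr 1
  refine (ENNReal.eq_inv_of_mul_eq_one_left ?_).symm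
  rw [mul_comm]; exact h1.symm

theorem uniformSphere_preimage_cone_eq_stdGaussian [NeZero m]
    {T : Set (EuclideanSpace ℝ (Fin m))} (hT : MeasurableSet T)
    (hcone : ∀ r : ℝ, 0 < r → ∀ x, r • x ∈ T ↔ x ∈ T) :
    uniformSphere m {a | (a : EuclideanSpace ℝ (Fin m)) ∈ T} =
      stdGaussian (EuclideanSpace ℝ (Fin m)) T := by
  have h := stdGaussian_eq_withDensity (EuclideanSpace ℝ (Fin m))
  rw [h]
  refine uniformSphere_preimage_cone (fun r => ENNReal.ofReal
    (((Real.pi / (1 / 2)) ^ (Module.finrank ℝ (EuclideanSpace ℝ (Fin m)) / 2 : ℝ))⁻¹ *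
        Real.exp (-(1 / 2) * r ^ 2))) (by fun_prop) ?_ hT hcone
  rw [← h]
  infer_instance

end Gaussian

/-! ### Measure of a band around a great subsphere -/

section Slab

theorem gaussianReal_abs_le_le (r : ℝ) :
    gaussianReal 0 1 {u | |u| ≤ r} ≤ ENNReal.ofReal (√(2 / Real.pi) * r) := by
  have hset : {u : ℝ | |u| ≤ r} = Set.Icc (-r) r := by ext u; simp [abs_le]
  rw [hset, gaussianReal_apply 0 one_ne_zero]
  have hb : ∀ x, gaussianPDF 0 1 x ≤ ENNReal.ofReal (√(2 * Real.pi))⁻¹ := by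
    intro x
    rw [gaussianPDF]
    apply ENNReal.ofReal_le_ofReal
    rw [gaussianPDFReal]
    simp only [NNReal.coe_one, mul_one, sub_zero]
    have : Real.exp (-x ^ 2 / 2) ≤ 1 := Real.exp_le_one_iff.2 (by nlinarith [sq_nonneg x])
    calc _ ≤ (√(2 * Real.pi))⁻¹ * 1 := by gcongr
      _ = _ := mul_one _
  calc ∫⁻ x in Set.Icc (-r) r, gaussianPDF 0 1 x
      ≤ ∫⁻ _ in Set.Icc (-r) r, ENNReal.ofReal (√(2 * Real.pi))⁻¹ := lintegral_mono hb
    _ = ENNReal.ofReal (√(2 / Real.pi) * r) := by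
      rw [setLIntegral_const, Real.volume_Icc, ← ENNReal.ofReal_mul (by positivity)]
      congr 1
      rw [Real.sqrt_div (by norm_num), Real.sqrt_mul (by norm_num)]
      have h2 : √2 * √2 = 2 := Real.mul_self_sqrt (by norm_num)
      field_simp
      rw [sq, h2]
      ring

/-- The inequality `√t ≤ (t / √k + √k) / 2` replaces the root by the sum of squares, whose mean is
`k`. -/
theorem lintegral_sqrt_sum_sq_gaussian_le (k : ℕ) (hk : 0 < k) {C : ℝ} (hC : 0 ≤ C) :
    ∫⁻ z : Fin k → ℝ, ENNReal.ofReal (C * √(∑ j, z j ^ 2))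
      ∂(Measure.pi fun _ => gaussianReal 0 1) ≤ ENNReal.ofReal (C * √k) := by
  have hk' : 0 < √(k : ℝ) := Real.sqrt_pos.2 (by exact_mod_cast hk)
  have hsq : ∫ x, x ^ 2 ∂(gaussianReal 0 1) = 1 := by
    have h := variance_fun_id_gaussianReal (μ := 0) (v := 1)
    rw [variance_eq_integral (by fun_prop)] at h
    simpa using h
  have hsqi : Integrable (fun x : ℝ => x ^ 2) (gaussianReal 0 1) :=
    (memLp_id_gaussianReal 2).integrable_sq
  have hi : ∀ j : Fin k, Integrable (fun z : Fin k → ℝ => z j ^ 2)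
      (Measure.pi fun _ => gaussianReal 0 1) := fun j =>
    (measurePreserving_eval (fun _ : Fin k => gaussianReal 0 1) j).integrable_comp_of_integrable
      hsqi
  have hint : ∫ z : Fin k → ℝ, ∑ j, z j ^ 2 ∂(Measure.pi fun _ => gaussianReal 0 1) = k := by
    rw [integral_finsetSum _ fun j _ => hi j]
    have : ∀ j : Fin k, ∫ z : Fin k → ℝ, z j ^ 2 ∂(Measure.pi fun _ => gaussianReal 0 1) = 1 := by
      intro j
      rw [integral_comp_eval (μ := fun _ : Fin k => gaussianReal 0 1) (f := fun x : ℝ => x ^ 2)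
        (by fun_prop), hsq]
    simp [this]
  have hsum : Integrable (fun z : Fin k → ℝ => ∑ j, z j ^ 2)
      (Measure.pi fun _ => gaussianReal 0 1) := integrable_finsetSum _ fun j _ => hi j
  calc _ ≤ ∫⁻ z : Fin k → ℝ, ENNReal.ofReal (C * (((∑ j, z j ^ 2) / √k + √k) / 2))
        ∂(Measure.pi fun _ => gaussianReal 0 1) := by
        refine lintegral_mono fun z => ENNReal.ofReal_le_ofReal ?_
        gcongr
        have h0 : 0 ≤ ∑ j, z j ^ 2 := Finset.sum_nonneg fun j _ => sq_nonneg _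
        have h1 := Real.sq_sqrt h0
        have h2 := Real.sq_sqrt (Nat.cast_nonneg (α := ℝ) k)
        rw [le_div_iff₀ (by norm_num), div_add' _ _ _ hk'.ne', le_div_iff₀ hk']
        nlinarith [sq_nonneg (√(∑ j, z j ^ 2) - √k)]
    _ = ENNReal.ofReal (∫ z : Fin k → ℝ, C * (((∑ j, z j ^ 2) / √k + √k) / 2)
        ∂(Measure.pi fun _ => gaussianReal 0 1)) := by
        rw [ofReal_integral_eq_lintegral_ofReal]
        · exact (((hsum.div_const _).add (integrable_const _)).div_const _).const_mul _
        · exact Filter.Eventually.of_forall fun z => by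
            have h0 : 0 ≤ ∑ j, z j ^ 2 := Finset.sum_nonneg fun j _ => sq_nonneg _
            positivity
    _ = _ := by
        congr 1
        rw [integral_const_mul, integral_div, integral_add (hsum.div_const _) (integrable_const _),
          integral_div, hint]
        simp only [integral_const, probReal_univ, one_smul]
        have h2 := Real.mul_self_sqrt (Nat.cast_nonneg (α := ℝ) k)
        congr 1
        field_simp
        nlinarith

/-- Fix the last `k` coordinates: the first lies in an interval, whose mass is controlled by the
maximum of the Gaussian density. Then average the interval length. -/
theorem pi_gaussianReal_cone_le (k : ℕ) (hk : 0 < k) {s : ℝ} (hs : 0 ≤ s) :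
    (Measure.pi fun _ : Fin (k + 1) => gaussianReal 0 1)
      {x | |x 0| ≤ s * √(∑ j : Fin k, x j.succ ^ 2)} ≤
        ENNReal.ofReal (√(2 / Real.pi) * s * √k) := by
  have hmp := measurePreserving_piFinSuccAbove (fun _ : Fin (k + 1) => gaussianReal 0 1) 0
  have hS : MeasurableSet {p : ℝ × (Fin k → ℝ) | |p.1| ≤ s * √(∑ j : Fin k, p.2 j ^ 2)} :=
    measurableSet_le (by fun_prop) (by fun_prop)
  have heq : {x : Fin (k + 1) → ℝ | |x 0| ≤ s * √(∑ j : Fin k, x j.succ ^ 2)} =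
      (MeasurableEquiv.piFinSuccAbove (fun _ => ℝ) 0) ⁻¹'
        {p : ℝ × (Fin k → ℝ) | |p.1| ≤ s * √(∑ j : Fin k, p.2 j ^ 2)} := by
    ext x; simp [MeasurableEquiv.piFinSuccAbove, Fin.tail]
  rw [heq, hmp.measure_preimage hS.nullMeasurableSet, Measure.prod_apply_symm hS]
  calc _ ≤ ∫⁻ z : Fin k → ℝ, ENNReal.ofReal (√(2 / Real.pi) * s * √(∑ j, z j ^ 2))
        ∂(Measure.pi fun _ => gaussianReal 0 1) := by
        refine lintegral_mono fun z => ?_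
        rw [mul_assoc]
        exact gaussianReal_abs_le_le _
    _ ≤ _ := lintegral_sqrt_sum_sq_gaussian_le k hk (by positivity)

variable {m : ℕ}

/-- The measure of a symmetric band around a great subsphere. -/
theorem uniformSphere_abs_inner_le (hm : 2 ≤ m) {v : EuclideanSpace ℝ (Fin m)} (hv : v ≠ 0)
    {s : ℝ} (hs : 0 ≤ s) (hs1 : s < 1) :
    uniformSphere m {a | |⟪(a : EuclideanSpace ℝ (Fin m)), v⟫| ≤ s * ‖v‖} ≤
      ENNReal.ofReal (√(2 / Real.pi) * (s / √(1 - s ^ 2)) * √((m : ℝ) - 1)) := by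
  obtain ⟨k, rfl⟩ : ∃ k, m = k + 1 := ⟨m - 1, by omega⟩
  have hvp : 0 < ‖v‖ := norm_pos_iff.2 hv
  let T : Set (EuclideanSpace ℝ (Fin (k + 1))) := {x | |⟪x, v⟫| ≤ s * ‖v‖ * ‖x‖}
  have hT : MeasurableSet T := measurableSet_le (by fun_prop) (by fun_prop)
  have hcone : ∀ r : ℝ, 0 < r → ∀ x, r • x ∈ T ↔ x ∈ T := by
    intro r hr x
    simp only [T, Set.mem_ofPred_eq, real_inner_smul_left, norm_smul, abs_mul, abs_of_pos hr,
      Real.norm_eq_abs]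
    rw [← mul_le_mul_iff_right₀ hr (b := |⟪x, v⟫|)]
    ring_nf
  have h1 : {a : sphere (0 : EuclideanSpace ℝ (Fin (k + 1))) 1 |
      |⟪(a : EuclideanSpace ℝ (Fin (k + 1))), v⟫| ≤ s * ‖v‖} =
      {a : sphere (0 : EuclideanSpace ℝ (Fin (k + 1))) 1 |
        (a : EuclideanSpace ℝ (Fin (k + 1))) ∈ T} := by
    ext a
    simp [T]
  rw [h1, uniformSphere_preimage_cone_eq_stdGaussian hT hcone]
  -- In an orthonormal basis starting with `v / ‖v‖`, the band condition is `x₀² ≤ s² (x₀² + G)`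
  -- with `G` the sum of the other squares. Solving for `x₀²` creates the slope `s / √(1 - s²)`.
  obtain ⟨b, hb⟩ := Orthonormal.exists_orthonormalBasis_extension_of_card_eq (𝕜 := ℝ)
    (E := EuclideanSpace ℝ (Fin (k + 1))) (ι := Fin (k + 1)) (by simp)
    (v := fun _ => ‖v‖⁻¹ • v) (s := {0}) (by
      constructor
      · intro i
        simp [norm_smul, hvp.ne']
      · intro i j hij
        exact absurd (Subsingleton.elim i j) hij)
  have hb0 : v = ‖v‖ • b 0 := by
    rw [hb 0 rfl, smul_smul, mul_inv_cancel₀ hvp.ne', one_smul]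
  rw [stdGaussian_eq_map_pi_orthonormalBasis b, Measure.map_apply (by fun_prop) hT]
  refine (measure_mono ?_).trans ((pi_gaussianReal_cone_le k (by omega)
    (s := s / √(1 - s ^ 2)) (by positivity)).trans_eq (by push_cast; ring_nf))
  intro x hx
  have hin : ⟪∑ i, x i • b i, v⟫ = ‖v‖ * x 0 := by
    conv_lhs => rw [hb0]
    rw [real_inner_smul_right, sum_inner]
    simp [real_inner_smul_left, b.inner_eq_ite]
  have hno : ‖∑ i, x i • b i‖ ^ 2 = x 0 ^ 2 + ∑ j : Fin k, x j.succ ^ 2 := by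
    rw [← Fin.sum_univ_succ (fun i => x i ^ 2), ← real_inner_self_eq_norm_sq, sum_inner]
    simp only [real_inner_smul_left, inner_sum, real_inner_smul_right, b.inner_eq_ite]
    simp [sq]
  have hx' : |⟪∑ i, x i • b i, v⟫| ≤ s * ‖v‖ * ‖∑ i, x i • b i‖ := hx
  rw [hin, abs_mul, abs_of_pos hvp, mul_comm s, mul_assoc] at hx'
  have hx2 := le_of_mul_le_mul_left hx' hvp
  have hs2 : 0 < 1 - s ^ 2 := by nlinarith
  have hG : 0 ≤ ∑ j : Fin k, x j.succ ^ 2 := Finset.sum_nonneg fun j _ => sq_nonneg _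
  rw [Set.mem_ofPred_eq]
  refine le_of_sq_le_sq ?_ (by positivity)
  rw [mul_pow, div_pow, Real.sq_sqrt hs2.le, Real.sq_sqrt hG, sq_abs, div_mul_eq_mul_div,
    le_div_iff₀ hs2]
  have h3 := pow_le_pow_left₀ (abs_nonneg _) hx2 2
  rw [mul_pow, sq_abs, hno] at h3
  nlinarith

end Slab

/-! ### Measure of a cap -/

section Band

variable {m : ℕ}

/-- An upper bound for the measure of the band `|⟪a, v⟫| ≤ s` around a great subsphere. -/
noncomputable def bandBound (m : ℕ) (s : ℝ) : ℝ :=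
  √(2 / Real.pi) * (s / √(1 - s ^ 2)) * √((m : ℝ) - 1)

@[simp]
theorem bandBound_zero (m : ℕ) : bandBound m 0 = 0 := by simp [bandBound]

theorem bandBound_nonneg (m : ℕ) {s : ℝ} (hs : 0 ≤ s) : 0 ≤ bandBound m s := by
  unfold bandBound; positivity

/-- Antipodal symmetry, inherited from the invariance of the Gaussian under negation. -/
theorem uniformSphere_inner_gt_eq [NeZero m] (v : EuclideanSpace ℝ (Fin m)) (s : ℝ) :
    uniformSphere m {a | s * ‖v‖ < ⟪(a : EuclideanSpace ℝ (Fin m)), v⟫} =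
      uniformSphere m {a | s * ‖v‖ < -⟪(a : EuclideanSpace ℝ (Fin m)), v⟫} := by
  let T : Set (EuclideanSpace ℝ (Fin m)) := {x | s * ‖v‖ * ‖x‖ < ⟪x, v⟫}
  have hT : MeasurableSet T := measurableSet_lt (by fun_prop) (by fun_prop)
  have hcone : ∀ r : ℝ, 0 < r → ∀ x, r • x ∈ T ↔ x ∈ T := by
    intro r hr x
    simp only [T, Set.mem_ofPred_eq, real_inner_smul_left, norm_smul, abs_of_pos hr,
      Real.norm_eq_abs]
    rw [← mul_lt_mul_iff_right₀ hr (c := ⟪x, v⟫)]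
    ring_nf
  let T' : Set (EuclideanSpace ℝ (Fin m)) := (LinearIsometryEquiv.neg ℝ) ⁻¹' T
  have hT' : MeasurableSet T' :=
    hT.preimage (LinearIsometryEquiv.neg ℝ (E := EuclideanSpace ℝ (Fin m))).continuous.measurable
  have hcone' : ∀ r : ℝ, 0 < r → ∀ x, r • x ∈ T' ↔ x ∈ T' := by
    intro r hr x
    have := hcone r hr (-x)
    simpa [T'] using this
  have h1 : {a : sphere (0 : EuclideanSpace ℝ (Fin m)) 1 |
      s * ‖v‖ < ⟪(a : EuclideanSpace ℝ (Fin m)), v⟫} =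
      {a : sphere (0 : EuclideanSpace ℝ (Fin m)) 1 | (a : EuclideanSpace ℝ (Fin m)) ∈ T} := by
    ext a; simp [T]
  have h2 : {a : sphere (0 : EuclideanSpace ℝ (Fin m)) 1 |
      s * ‖v‖ < -⟪(a : EuclideanSpace ℝ (Fin m)), v⟫} =
      {a : sphere (0 : EuclideanSpace ℝ (Fin m)) 1 | (a : EuclideanSpace ℝ (Fin m)) ∈ T'} := by
    ext a; simp [T, T']
  rw [h1, h2, uniformSphere_preimage_cone_eq_stdGaussian hT hcone,
    uniformSphere_preimage_cone_eq_stdGaussian hT' hcone']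
  conv_lhs => rw [← stdGaussian_map (LinearIsometryEquiv.neg ℝ (E := EuclideanSpace ℝ (Fin m)))]
  rw [Measure.map_apply (LinearIsometryEquiv.continuous _).measurable hT]

/-- The measure of a cap slightly larger than a half-sphere. -/
theorem uniformSphere_inner_le (hm : 2 ≤ m) {v : EuclideanSpace ℝ (Fin m)} (hv : v ≠ 0)
    {s : ℝ} (hs : 0 ≤ s) (hs1 : s < 1) :
    uniformSphere m {a | ⟪(a : EuclideanSpace ℝ (Fin m)), v⟫ ≤ s * ‖v‖} ≤
      ENNReal.ofReal (1 / 2 + bandBound m s / 2) := by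
  have : NeZero m := ⟨by omega⟩
  have hband := uniformSphere_abs_inner_le hm hv hs hs1
  change _ ≤ ENNReal.ofReal (bandBound m s) at hband
  have hsym := uniformSphere_inner_gt_eq v s
  set σ := uniformSphere m
  set P : Set (sphere (0 : EuclideanSpace ℝ (Fin m)) 1) :=
    {a | s * ‖v‖ < ⟪(a : EuclideanSpace ℝ (Fin m)), v⟫} with hP
  set Q : Set (sphere (0 : EuclideanSpace ℝ (Fin m)) 1) :=
    {a | s * ‖v‖ < -⟪(a : EuclideanSpace ℝ (Fin m)), v⟫} with hQ
  have hPm : MeasurableSet P := measurableSet_lt (by fun_prop) (by fun_prop)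
  have hQm : MeasurableSet Q := measurableSet_lt (by fun_prop) (by fun_prop)
  have h1 : {a : sphere (0 : EuclideanSpace ℝ (Fin m)) 1 |
      ⟪(a : EuclideanSpace ℝ (Fin m)), v⟫ ≤ s * ‖v‖} = Pᶜ := by
    ext a; simp [hP]
  have h2 : {a : sphere (0 : EuclideanSpace ℝ (Fin m)) 1 |
      |⟪(a : EuclideanSpace ℝ (Fin m)), v⟫| ≤ s * ‖v‖} = (P ∪ Q)ᶜ := by
    ext a; simp [hP, hQ, abs_le']
  have hsv : 0 ≤ s * ‖v‖ := by positivity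
  have hd : Disjoint P Q := by
    rw [Set.disjoint_left]
    intro a ha hb
    simp only [hP, hQ, Set.mem_ofPred_eq] at ha hb
    linarith
  rw [h2] at hband
  rw [h1]
  -- The sphere splits into the band and two opposite caps of equal measure, so the complement of
  -- one cap has measure 1/2 plus half the band.
  have e1 : σ.real Pᶜ = 1 - σ.real P := probReal_compl_eq_one_sub hPm
  have e2 : σ.real (P ∪ Q)ᶜ = 1 - σ.real (P ∪ Q) := probReal_compl_eq_one_sub (hPm.union hQm)
  have e3 : σ.real (P ∪ Q) = σ.real P + σ.real Q := measureReal_union hd hQm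
  have e4 : σ.real P = σ.real Q := by rw [measureReal_def, hsym, measureReal_def]
  have e5 : σ.real (P ∪ Q)ᶜ ≤ bandBound m s :=
    ENNReal.toReal_le_of_le_ofReal (bandBound_nonneg m hs) hband
  rw [← ofReal_measureReal]
  apply ENNReal.ofReal_le_ofReal
  linarith

end Band

/-! ### Conditioning on a subset of coordinates -/

section Product

variable {ι X : Type*} [Fintype ι] [DecidableEq ι] [MeasurableSpace X]

theorem measurePreserving_piecewise (μ : ι → Measure X) [∀ i, IsProbabilityMeasure (μ i)]
    (I : Finset ι) :
    MeasurePreserving (fun p : (ι → X) × (ι → X) => I.piecewise p.1 p.2)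
      ((Measure.pi μ).prod (Measure.pi μ)) (Measure.pi μ) := by
  have hmeas : Measurable (fun p : (ι → X) × (ι → X) => I.piecewise p.1 p.2) := by
    refine measurable_pi_lambda _ fun i => ?_
    by_cases hi : i ∈ I
    · simp only [Finset.piecewise_eq_of_mem _ _ _ hi]; fun_prop
    · simp only [Finset.piecewise_eq_of_notMem _ _ _ hi]; fun_prop
  refine ⟨hmeas, (Measure.pi_eq fun s hs => ?_).symm⟩
  rw [Measure.map_apply hmeas (MeasurableSet.univ_pi hs)]
  have hset : (fun p : (ι → X) × (ι → X) => I.piecewise p.1 p.2) ⁻¹' Set.univ.pi s =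
      (Set.univ.pi fun i => if i ∈ I then s i else Set.univ) ×ˢ
        (Set.univ.pi fun i => if i ∈ I then Set.univ else s i) := by
    ext p
    simp only [Set.mem_preimage, Set.mem_pi, Set.mem_univ, true_implies, Set.mem_prod,
      ← forall_and]
    refine forall_congr' fun i => ?_
    by_cases hi : i ∈ I <;> simp [hi]
  rw [hset, Measure.prod_prod, Measure.pi_pi, Measure.pi_pi, ← Finset.prod_mul_distrib]
  refine Finset.prod_congr rfl fun i _ => ?_
  by_cases hi : i ∈ I <;> simp [hi]

/-- Resampling the coordinates outside `I` leaves the law unchanged. This is Fubini in a form that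
keeps the index type whole. -/
theorem pi_apply_eq_lintegral_piecewise (μ : ι → Measure X) [∀ i, IsProbabilityMeasure (μ i)]
    (I : Finset ι) {S : Set (ι → X)} (hS : MeasurableSet S) :
    Measure.pi μ S = ∫⁻ a, Measure.pi μ {b | I.piecewise a b ∈ S} ∂(Measure.pi μ) := by
  have h := measurePreserving_piecewise μ I
  rw [← h.measure_preimage hS.nullMeasurableSet, Measure.prod_apply (h.measurable hS)]
  rfl

end Product

/-! ### Random rows: general position and the tail estimate -/

section Events

variable {n m : ℕ}

theorem measurableSet_linearIndepOn (J : Finset (Fin n)) :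
    MeasurableSet {a : Fin n → sphere (0 : EuclideanSpace ℝ (Fin m)) 1 |
      LinearIndepOn ℝ (fun i => (a i : EuclideanSpace ℝ (Fin m))) J} := by
  have h : IsOpen {f : J → EuclideanSpace ℝ (Fin m) | LinearIndependent ℝ f} :=
    isOpen_setOfPred_linearIndependent
  have hc : Continuous fun (a : Fin n → sphere (0 : EuclideanSpace ℝ (Fin m)) 1) (i : J) =>
      (a i : EuclideanSpace ℝ (Fin m)) := by fun_prop
  exact (h.preimage hc).measurableSet

/-- Add one row at a time: fewer than `m` rows span a proper subspace, and a fresh row lies in it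
only if it falls in a band of width 0. -/
theorem ae_linearIndepOn (hm : 2 ≤ m) (J : Finset (Fin n)) (hJ : J.card ≤ m) :
    ∀ᵐ a ∂(Measure.pi fun _ : Fin n => uniformSphere m),
      LinearIndepOn ℝ (fun i => (a i : EuclideanSpace ℝ (Fin m))) J := by
  have : NeZero m := ⟨by omega⟩
  induction J using Finset.induction_on with
  | empty => simp
  | insert j J hj ih =>
    rw [Finset.card_insert_of_notMem hj] at hJ
    have ih := ih (by omega)
    change Measure.pi (fun _ : Fin n => uniformSphere m)
      {a : Fin n → sphere (0 : EuclideanSpace ℝ (Fin m)) 1 |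
        LinearIndepOn ℝ (fun i => (a i : EuclideanSpace ℝ (Fin m))) (insert j J : Finset _)}ᶜ = 0
    rw [pi_apply_eq_lintegral_piecewise _ J (measurableSet_linearIndepOn _).compl,
      lintegral_eq_zero_iff' (by
        have h := (measurePreserving_piecewise (fun _ : Fin n => uniformSphere m) J).measurable
          ((measurableSet_linearIndepOn (m := m) (insert j J)).compl)
        exact (measurable_measure_prodMk_left h).aemeasurable)]
    filter_upwards [ih] with a ha
    set W := Submodule.span ℝ ((fun i => (a i : EuclideanSpace ℝ (Fin m))) '' (J : Set (Fin n)))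
    obtain ⟨v, hvW, hv⟩ : ∃ v ∈ Wᗮ, v ≠ 0 := by
      apply Submodule.exists_mem_ne_zero_of_ne_bot
      rw [Ne, Submodule.orthogonal_eq_bot_iff]
      intro htop
      have h1 : Module.finrank ℝ W ≤ J.card := by
        classical
        have h := finrank_span_finset_le_card (R := ℝ)
          (J.image fun i => (a i : EuclideanSpace ℝ (Fin m)))
        rw [Finset.coe_image] at h
        exact h.trans Finset.card_image_le
      rw [htop, finrank_top, finrank_euclideanSpace_fin] at h1
      omega
    refine le_antisymm ?_ zero_le
    have hz := uniformSphere_abs_inner_le hm hv le_rfl one_pos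
    change _ ≤ ENNReal.ofReal (bandBound m 0) at hz
    rw [bandBound_zero, ENNReal.ofReal_zero] at hz
    refine le_trans ?_ hz
    rw [← (measurePreserving_eval (fun _ : Fin n => uniformSphere m) j).measure_preimage
      (measurableSet_le (by fun_prop) (by fun_prop)).nullMeasurableSet]
    refine measure_mono fun b hb => ?_
    by_contra hcon
    refine hb ?_
    rw [Set.mem_ofPred_eq, Finset.coe_insert, linearIndepOn_insert (by simpa using hj)]
    have heq : Set.EqOn (fun i => ((J.piecewise a b) i : EuclideanSpace ℝ (Fin m)))
        (fun i => (a i : EuclideanSpace ℝ (Fin m))) (J : Set (Fin n)) := fun i hi => by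
      simp [Finset.piecewise_eq_of_mem _ _ _ (Finset.mem_coe.1 hi)]
    refine ⟨ha.congr heq.symm, fun hmem => hcon ?_⟩
    rw [heq.image_eq] at hmem
    have h0 := (Submodule.mem_orthogonal _ _).1 hvW _ hmem
    rw [Finset.piecewise_eq_of_notMem _ _ _ hj] at h0
    simp [h0]

theorem ae_generalPosition (hm : 2 ≤ m) :
    ∀ᵐ a ∂(Measure.pi fun _ : Fin n => uniformSphere m),
      GeneralPosition fun i => (a i : EuclideanSpace ℝ (Fin m)) := by
  unfold GeneralPosition
  rw [ae_all_iff]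
  intro J
  by_cases hJ : J.card ≤ m
  · filter_upwards [ae_linearIndepOn hm J hJ] with a ha _ using ha
  · exact Filter.Eventually.of_forall fun a h => absurd (by simpa using h) hJ

/-- The rows with indices in `I`. -/
def selectRows (I : Finset (Fin n)) (hI : I.card = m)
    (a : Fin n → sphere (0 : EuclideanSpace ℝ (Fin m)) 1) (i : Fin m) :
    EuclideanSpace ℝ (Fin m) := a (I.orderEmbOfFin hI i)

theorem continuous_selectRows (I : Finset (Fin n)) (hI : I.card = m) :
    Continuous (selectRows I hI) := by
  unfold selectRows; fun_prop

theorem linearIndependent_selectRows {I : Finset (Fin n)} (hI : I.card = m)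
    {a : Fin n → sphere (0 : EuclideanSpace ℝ (Fin m)) 1}
    (ha : LinearIndepOn ℝ (fun i => (a i : EuclideanSpace ℝ (Fin m))) I) :
    LinearIndependent ℝ (selectRows I hI a) :=
  LinearIndependent.comp ha (fun i => ⟨I.orderEmbOfFin hI i, I.orderEmbOfFin_mem hI i⟩)
    fun _ _ hij => (I.orderEmbOfFin hI).injective (Subtype.ext_iff.1 hij)

/-- The `i`-th selected row is close to the span of the other selected rows. -/
def bandEvent (I : Finset (Fin n)) (hI : I.card = m) (s : ℝ) (i : Fin m) :
    Set (Fin n → sphere (0 : EuclideanSpace ℝ (Fin m)) 1) :=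
  {a | |⟪selectRows I hI a i, cofactorVec (selectRows I hI a) i⟫| ≤
    s * ‖cofactorVec (selectRows I hI a) i‖}

theorem measurableSet_bandEvent (I : Finset (Fin n)) (hI : I.card = m) (s : ℝ) (i : Fin m) :
    MeasurableSet (bandEvent I hI s i) := by
  have h1 : Continuous fun a => selectRows I hI a i :=
    (continuous_apply i).comp (continuous_selectRows I hI)
  have h2 : Continuous fun a => cofactorVec (selectRows I hI a) i :=
    (continuous_cofactorVec i).comp (continuous_selectRows I hI)
  exact (isClosed_le (h1.inner h2).abs (h2.norm.const_mul s)).measurableSet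

/-- Freeze every row except the `i`-th selected one: the cofactor vector is then a fixed vector,
almost surely nonzero. -/
theorem measure_bandEvent_le (hm : 2 ≤ m) (I : Finset (Fin n)) (hI : I.card = m) {s : ℝ}
    (hs : 0 ≤ s) (hs1 : s < 1) (i : Fin m) :
    Measure.pi (fun _ : Fin n => uniformSphere m) (bandEvent I hI s i) ≤
      ENNReal.ofReal (bandBound m s) := by
  have : NeZero m := ⟨by omega⟩
  rw [pi_apply_eq_lintegral_piecewise _ (Finset.univ.erase (I.orderEmbOfFin hI i))
    (measurableSet_bandEvent I hI s i)]
  calc _ ≤ ∫⁻ _, ENNReal.ofReal (bandBound m s)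
        ∂(Measure.pi fun _ : Fin n => uniformSphere m) := ?_
    _ = _ := by simp
  refine lintegral_mono_ae ?_
  filter_upwards [ae_linearIndepOn hm I hI.le] with a ha
  have hv := cofactorVec_ne_zero (linearIndependent_selectRows hI ha) i
  set v := cofactorVec (selectRows I hI a) i with hvdef
  refine le_trans ?_ (uniformSphere_abs_inner_le hm hv hs hs1)
  rw [← (measurePreserving_eval (fun _ : Fin n => uniformSphere m)
    (I.orderEmbOfFin hI i)).measure_preimage
      (measurableSet_le (by fun_prop) (by fun_prop)).nullMeasurableSet]
  refine measure_mono fun b hb => ?_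
  have h1 : cofactorVec (selectRows I hI
      ((Finset.univ.erase (I.orderEmbOfFin hI i)).piecewise a b)) i = v := by
    refine cofactorVec_congr fun k hk => ?_
    have : I.orderEmbOfFin hI k ∈ Finset.univ.erase (I.orderEmbOfFin hI i) := by
      simpa using hk
    simp only [selectRows, Finset.piecewise_eq_of_mem _ _ _ this]
  have h2 : selectRows I hI ((Finset.univ.erase (I.orderEmbOfFin hI i)).piecewise a b) i =
      b (I.orderEmbOfFin hI i) := by
    simp only [selectRows]
    rw [Finset.piecewise_eq_of_notMem _ _ _ (by simp)]
  simp only [bandEvent, Set.mem_ofPred_eq, h1, h2] at hb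
  exact hb

/-- All rows outside `I` lie on one side of a hyperplane determined by the rows in `I`. -/
def sideEvent (I : Finset (Fin n)) (hI : I.card = m) (b s : ℝ) :
    Set (Fin n → sphere (0 : EuclideanSpace ℝ (Fin m)) 1) :=
  {a | ∀ j ∉ I, ⟪(a j : EuclideanSpace ℝ (Fin m)), b • hyperplaneNormal (selectRows I hI a)⟫ ≤
    s * ‖b • hyperplaneNormal (selectRows I hI a)‖}

theorem measurableSet_sideEvent (I : Finset (Fin n)) (hI : I.card = m) (b s : ℝ) :
    MeasurableSet (sideEvent I hI b s) := by
  have h2 : Continuous fun a => b • hyperplaneNormal (selectRows I hI a) :=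
    (continuous_hyperplaneNormal.comp (continuous_selectRows I hI)).const_smul b
  have : sideEvent I hI b s = ⋂ j, ⋂ (_ : j ∉ I),
      {a | ⟪(a j : EuclideanSpace ℝ (Fin m)), b • hyperplaneNormal (selectRows I hI a)⟫ ≤
        s * ‖b • hyperplaneNormal (selectRows I hI a)‖} := by
    ext a; simp [sideEvent]
  rw [this]
  refine MeasurableSet.iInter fun j => MeasurableSet.iInter fun _ => ?_
  have h1 : Continuous fun a : Fin n → sphere (0 : EuclideanSpace ℝ (Fin m)) 1 =>
      (a j : EuclideanSpace ℝ (Fin m)) := by fun_prop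
  exact (isClosed_le (h1.inner h2) (h2.norm.const_mul s)).measurableSet

/-- Condition on the rows in `I`. The band events and the normal depend on these alone, and the side
event becomes `n - m` independent cap events. -/
theorem measure_iUnion_bandEvent_inter_sideEvent_le (hm : 2 ≤ m) (I : Finset (Fin n))
    (hI : I.card = m) {s t b : ℝ} (hs : 0 ≤ s) (hs1 : s < 1) (ht : 0 ≤ t) (ht1 : t < 1)
    (hb : b ≠ 0) :
    Measure.pi (fun _ : Fin n => uniformSphere m)
      ((⋃ i, bandEvent I hI s i) ∩ sideEvent I hI b t) ≤
      ENNReal.ofReal (m * bandBound m s * (1 / 2 + bandBound m t / 2) ^ (n - m)) := by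
  classical
  have : NeZero m := ⟨by omega⟩
  have hB : MeasurableSet (⋃ i, bandEvent I hI s i) :=
    MeasurableSet.iUnion fun i => measurableSet_bandEvent I hI s i
  have hBle : Measure.pi (fun _ : Fin n => uniformSphere m) (⋃ i, bandEvent I hI s i) ≤
      ENNReal.ofReal (m * bandBound m s) := by
    refine (measure_iUnion_fintype_le _ _).trans ?_
    calc _ ≤ ∑ _i : Fin m, ENNReal.ofReal (bandBound m s) :=
          Finset.sum_le_sum fun i _ => measure_bandEvent_le hm I hI hs hs1 i
      _ = _ := by
        rw [Finset.sum_const, Finset.card_univ, Fintype.card_fin, nsmul_eq_mul,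
          ENNReal.ofReal_mul (by positivity), ENNReal.ofReal_natCast]
  rw [pi_apply_eq_lintegral_piecewise _ I (hB.inter (measurableSet_sideEvent I hI b t))]
  set q := ENNReal.ofReal (1 / 2 + bandBound m t / 2) with hq
  calc _ ≤ ∫⁻ a, (⋃ i, bandEvent I hI s i).indicator (fun _ => q ^ (n - m)) a
        ∂(Measure.pi fun _ : Fin n => uniformSphere m) := ?_
    _ = q ^ (n - m) * Measure.pi (fun _ : Fin n => uniformSphere m)
        (⋃ i, bandEvent I hI s i) := lintegral_indicator_const hB _
    _ ≤ q ^ (n - m) * ENNReal.ofReal (m * bandBound m s) := by gcongr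
    _ = _ := by
      have := bandBound_nonneg m ht
      have h2 := bandBound_nonneg m hs
      rw [hq, ← ENNReal.ofReal_pow (by positivity), mul_comm, ← ENNReal.ofReal_mul (by positivity)]
  refine lintegral_mono_ae ?_
  filter_upwards [ae_linearIndepOn hm I hI.le] with a ha
  have hsel : ∀ c, selectRows I hI (I.piecewise a c) = selectRows I hI a := by
    intro c
    ext1 i
    simp only [selectRows, Finset.piecewise_eq_of_mem _ _ _ (I.orderEmbOfFin_mem hI i)]
  by_cases haB : a ∈ ⋃ i, bandEvent I hI s i
  · rw [Set.indicator_of_mem haB]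
    set v := b • hyperplaneNormal (selectRows I hI a) with hv
    have hv0 : v ≠ 0 :=
      smul_ne_zero hb (hyperplaneNormal_ne_zero (linearIndependent_selectRows hI ha))
    calc _ ≤ Measure.pi (fun _ : Fin n => uniformSphere m) (Set.univ.pi fun j =>
          if j ∈ I then Set.univ else {x | ⟪(x : EuclideanSpace ℝ (Fin m)), v⟫ ≤ t * ‖v‖}) := by
          refine measure_mono fun c hc j _ => ?_
          by_cases hj : j ∈ I
          · simp [hj]
          · have := hc.2 j hj
            rw [hsel, Finset.piecewise_eq_of_notMem _ _ _ hj] at this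
            simpa [hj] using this
      _ = ∏ j, uniformSphere m (if j ∈ I then Set.univ else
          {x | ⟪(x : EuclideanSpace ℝ (Fin m)), v⟫ ≤ t * ‖v‖}) := Measure.pi_pi _ _
      _ ≤ ∏ j, if j ∈ I then 1 else q := by
          refine Finset.prod_le_prod' fun j _ => ?_
          by_cases hj : j ∈ I
          · simp [hj]
          · simpa [hj, hq] using uniformSphere_inner_le hm hv0 ht ht1
      _ = q ^ (n - m) := by
          rw [Finset.prod_ite]
          simp only [Finset.prod_const_one, one_mul, Finset.prod_const]
          congr 1
          rw [Finset.filter_not, Finset.card_sdiff_of_subset (Finset.filter_subset _ _)]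
          simp [hI]
  · rw [Set.indicator_of_notMem haB, nonpos_iff_eq_zero]
    refine measure_mono_null (t := ∅) (fun c hc => ?_) measure_empty
    refine haB ?_
    have := hc.1
    simp only [bandEvent, Set.mem_iUnion, Set.mem_ofPred_eq, hsel] at this ⊢
    exact this

/-- Tail estimate for the cosine of `θ(A)`. -/
theorem measure_abs_cos_theta_lt_le (hm : 2 ≤ m) (hmn : m ≤ n) {ε : ℝ} (hε : 0 < ε)
    (hε1 : m * ε < 1) :
    Measure.pi (fun _ : Fin n => uniformSphere m)
      {a | |Real.cos (theta (matrixOfRows a))| < ε} ≤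
      ENNReal.ofReal (n.choose m * (m * bandBound m (m * ε) *
        ((1 / 2 + bandBound m ε / 2) ^ (n - m) + (1 / 2) ^ (n - m)))) := by
  have : NeZero m := ⟨by omega⟩
  have : NeZero n := ⟨by omega⟩
  have hm1 : (1 : ℝ) ≤ m := by exact_mod_cast (by omega : 1 ≤ m)
  have hεlt : ε < 1 := by nlinarith
  have hmε : 0 ≤ m * ε := by positivity
  -- For `b = 1` the threshold is `ε`. For `b = -1` only nonpositivity is kept, as `‖y‖` has no
  -- upper bound; the cap is a half-sphere and contributes `(1/2)^(n - m)`.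
  let G : ℝ → {I : Finset (Fin n) // I.card = m} → Set _ := fun b I =>
    (⋃ i, bandEvent I.1 I.2 (m * ε) i) ∩ sideEvent I.1 I.2 b (max 0 (b * ε))
  have hsub : {a | |Real.cos (theta (matrixOfRows a))| < ε} ≤ᵐ[Measure.pi
      (fun _ : Fin n => uniformSphere m)] ((⋃ I, G 1 I ∪ G (-1) I : Set _)) := by
    filter_upwards [ae_generalPosition hm] with a ha hcos
    obtain ⟨b, hb, I, hI, hlin, y, hyn, hy, hyle⟩ :=
      exists_tight_hyperplane a hmn ha hε hεlt.le hcos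
    have hli := linearIndependent_selectRows hI hlin
    have hy' : ∀ i, ⟪selectRows I hI a i, y⟫ = b := fun i => hy _ (I.orderEmbOfFin_mem hI i)
    have hG : a ∈ G b ⟨I, hI⟩ := by
      refine ⟨Set.mem_iUnion.2 (exists_abs_inner_cofactorVec_le hli hb hy' hε hyn), ?_⟩
      exact fun j _ => inner_hyperplaneNormal_le hli hb hy' hε hyn (hyle j)
    refine Set.mem_iUnion.2 ⟨⟨I, hI⟩, ?_⟩
    rcases hb with rfl | rfl
    · exact Or.inl hG
    · exact Or.inr hG
  have hbnn := bandBound_nonneg m hmε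
  have hbnn' := bandBound_nonneg m hε.le
  have hI : ∀ I, Measure.pi (fun _ : Fin n => uniformSphere m) (G 1 I ∪ G (-1) I) ≤
      ENNReal.ofReal (m * bandBound m (m * ε) *
        ((1 / 2 + bandBound m ε / 2) ^ (n - m) + (1 / 2) ^ (n - m))) := by
    intro I
    refine (measure_union_le _ _).trans ?_
    rw [mul_add, ENNReal.ofReal_add (by positivity) (by positivity)]
    refine add_le_add ?_ ?_
    · have := measure_iUnion_bandEvent_inter_sideEvent_le hm I.1 I.2 hmε hε1 hε.le hεlt
        one_ne_zero
      simpa only [G, one_mul, max_eq_right hε.le] using this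
    · have := measure_iUnion_bandEvent_inter_sideEvent_le hm I.1 I.2 hmε hε1 le_rfl one_pos
        (b := -1) (by norm_num)
      have h0 : max 0 (-1 * ε) = 0 := max_eq_left (by linarith)
      rw [bandBound_zero, zero_div, add_zero] at this
      simpa only [G, h0] using this
  refine (measure_mono_ae hsub).trans ((measure_iUnion_fintype_le _ _).trans
    ((Finset.sum_le_sum fun I _ => hI I).trans_eq ?_))
  rw [Finset.sum_const, nsmul_eq_mul, ENNReal.ofReal_mul (p := (n.choose m : ℝ)) (by positivity),
    ENNReal.ofReal_natCast]
  congr 2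
  rw [Finset.card_univ]
  simp [Fintype.card_finset_len]

end Events

/-! ### Explicit constants in the tail estimate -/

section Numerics

theorem choose_add_div_two_pow_succ (m k : ℕ) :
    ((m + (k + 1)).choose m : ℝ) / 2 ^ (k + 1) =
      (m + k).choose m / 2 ^ k * ((m + k + 1) / (2 * (k + 1))) := by
  have h := Nat.add_one_mul_choose_eq (m + k) k
  have h1 : (m + k).choose k = (m + k).choose m := Nat.choose_symm_add.symm
  have h2 : (m + k + 1).choose (k + 1) = (m + (k + 1)).choose m :=
    (Nat.choose_symm_add (a := m) (b := k + 1)).symm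
  rw [h1, h2] at h
  have h' : ((m : ℝ) + k + 1) * (m + k).choose m = (m + (k + 1)).choose m * (k + 1) := by
    exact_mod_cast h
  rw [pow_succ, div_mul_div_comm, div_eq_div_iff (by positivity) (by positivity)]
  linear_combination (-(2 ^ k * 2)) * h'

/-- The maximum of `choose (m + k) m / 2 ^ k` over `k` is attained at `k = m`. -/
theorem choose_add_div_two_pow_le (m k : ℕ) :
    ((m + k).choose m : ℝ) / 2 ^ k ≤ (m + m).choose m / 2 ^ m := by
  rcases le_total k m with h | h
  · induction h using Nat.decreasingInduction with
    | self => rfl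
    | of_succ k hk ih =>
      refine le_trans ?_ ih
      rw [choose_add_div_two_pow_succ]
      refine le_mul_of_one_le_right (by positivity) ?_
      rw [one_le_div (by positivity)]
      have : (k : ℝ) + 1 ≤ m := by exact_mod_cast hk
      linarith
  · induction k, h using Nat.le_induction with
    | base => rfl
    | succ k hk ih =>
      refine le_trans ?_ ih
      rw [choose_add_div_two_pow_succ]
      refine mul_le_of_le_one_right (by positivity) ?_
      rw [div_le_one (by positivity)]
      have : (m : ℝ) ≤ k := by exact_mod_cast hk
      linarith

theorem central_choose_div_two_pow_succ (m : ℕ) :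
    ((m + 1 + (m + 1)).choose (m + 1) : ℝ) / 2 ^ (m + 1) =
      (m + m).choose m / 2 ^ m * ((2 * m + 1) / (m + 1)) := by
  have h := Nat.succ_mul_centralBinom_succ m
  rw [Nat.centralBinom, Nat.centralBinom] at h
  have h' : ((m : ℝ) + 1) * (m + 1 + (m + 1)).choose (m + 1) =
      2 * (2 * m + 1) * (m + m).choose m := by
    rw [← two_mul, ← two_mul]
    exact_mod_cast h
  rw [pow_succ]
  have hk : (0 : ℝ) < m + 1 := by positivity
  field_simp
  linarith

/-- With `m = k + 3` the right side is `(m + 2)^m`. In the induction, Bernoulli's inequality gives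
enough growth on the right to absorb the ratio of successive left sides. -/
theorem central_choose_bound (k : ℕ) :
    81 / 200 * (((k + 3 + (k + 3)).choose (k + 3) : ℝ) / 2 ^ (k + 3)) ^ 2 *
      ((k + 3) * (k + 2) * (k + 6)) ≤ ((k : ℝ) + 5) ^ (k + 3) := by
  induction k with
  | zero => norm_num [Nat.choose]
  | succ k ih =>
    have h1 := central_choose_div_two_pow_succ (k + 3)
    have e : k + 1 + 3 = k + 3 + 1 := by omega
    rw [e, h1]
    set G := ((k + 3 + (k + 3)).choose (k + 3) : ℝ) / 2 ^ (k + 3)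
    push_cast
    have hb : 1 + (k + 3 : ℝ) * (1 / (k + 5)) ≤ (1 + 1 / ((k : ℝ) + 5)) ^ (k + 3) := by
      have := one_add_mul_le_pow (a := 1 / ((k : ℝ) + 5))
        (by have : (0 : ℝ) ≤ 1 / (k + 5) := by positivity
            linarith) (k + 3)
      exact_mod_cast this
    have hp : ((k : ℝ) + 6) ^ (k + 3) = (k + 5) ^ (k + 3) * (1 + 1 / ((k : ℝ) + 5)) ^ (k + 3) := by
      rw [← mul_pow]; congr 1; field_simp; ring
    have hk : (0 : ℝ) ≤ k := Nat.cast_nonneg k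
    calc 81 / 200 * (G * ((2 * ((k : ℝ) + 3) + 1) / (k + 3 + 1))) ^ 2 *
          (((k : ℝ) + 1 + 3) * (k + 1 + 2) * (k + 1 + 6))
        = (81 / 200 * G ^ 2 * (((k : ℝ) + 3) * (k + 2) * (k + 6))) *
          ((2 * (k : ℝ) + 7) ^ 2 * (k + 7) / ((k + 4) * (k + 2) * (k + 6))) := by
          have e4 : (k : ℝ) + 3 + 1 = k + 4 := by ring
          rw [e4]
          field_simp
          ring
      _ ≤ ((k : ℝ) + 5) ^ (k + 3) * ((k + 6) * (1 + (k + 3) * (1 / (k + 5)))) := by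
          refine mul_le_mul ih ?_ (by positivity) (by positivity)
          rw [div_le_iff₀ (by positivity)]
          have : (1 + ((k : ℝ) + 3) * (1 / (k + 5))) = (2 * k + 8) / (k + 5) := by
            field_simp; ring
          rw [this, mul_div_assoc', div_mul_eq_mul_div, le_div_iff₀ (by positivity)]
          have h0 : 0 ≤ (k + 6) * (2 * k + 8) * ((k + 4) * (k + 2) * (k + 6)) -
              ((2 * (k : ℝ) + 7) ^ 2 * (k + 7) * (k + 5)) := by
            ring_nf; positivity
          linarith
      _ ≤ ((k : ℝ) + 5) ^ (k + 3) * ((k + 6) * (1 + 1 / ((k : ℝ) + 5)) ^ (k + 3)) := by gcongr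
      _ = ((k : ℝ) + 1 + 5) ^ (k + 3 + 1) := by
          rw [show (k : ℝ) + 1 + 5 = k + 6 by ring, pow_succ ((k : ℝ) + 6), hp]; ring

/-- For `n ≥ m + 2` the central case dominates and `(m + 2)^m ≤ n^m`; the cases `n = m` and `n = m +
1` are separate. -/
theorem choose_bound {n m : ℕ} (hm : 3 ≤ m) (hmn : m ≤ n) :
    7 / 5 * ((n.choose m : ℝ) / 2 ^ (n - m)) ^ 2 * (m * √m * (m - 1)) ≤ (n : ℝ) ^ m := by
  obtain ⟨k, rfl⟩ : ∃ k, n = m + k := ⟨n - m, by omega⟩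
  rw [Nat.add_sub_cancel_left]
  have hm3 : (3 : ℝ) ≤ m := by exact_mod_cast hm
  have hm0 : (0 : ℝ) ≤ m := by linarith
  have hR := Real.sq_sqrt hm0
  rcases Nat.lt_or_ge k 2 with hk | hk
  · interval_cases k
    · simp only [add_zero, Nat.choose_self, pow_zero, Nat.cast_one, div_one, one_pow, mul_one]
      have h1 : √(m : ℝ) ≤ (m + 1) / 2 := by nlinarith [sq_nonneg (√(m : ℝ) - 1)]
      calc 7 / 5 * ((m : ℝ) * √m * (m - 1)) ≤ 7 / 5 * (m * ((m + 1) / 2) * (m - 1)) := by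
            have : (0 : ℝ) ≤ m - 1 := by linarith
            gcongr
        _ ≤ (m : ℝ) ^ 3 := by nlinarith [mul_nonneg hm0 hm0]
        _ ≤ _ := pow_le_pow_right₀ (by linarith) hm
    · have hc : (m + 1).choose m = m + 1 := by simp
      rw [hc]
      push_cast
      rcases Nat.lt_or_ge m 5 with h5 | h5
      · have h3 : √(3 : ℝ) ≤ 7 / 4 := by rw [Real.sqrt_le_left (by norm_num)]; norm_num
        interval_cases m
        · norm_num; linarith
        · norm_num
      · have hm5 : (5 : ℝ) ≤ m := by exact_mod_cast h5
        have h1 : √(m : ℝ) ≤ m / 2 := by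
          rw [Real.sqrt_le_left (by positivity)]; nlinarith
        calc 7 / 5 * (((m : ℝ) + 1) / 2 ^ 1) ^ 2 * (m * √m * (m - 1))
            ≤ 7 / 5 * (((m : ℝ) + 1) / 2 ^ 1) ^ 2 * (m * (m / 2) * (m - 1)) := by
              have : (0 : ℝ) ≤ m - 1 := by linarith
              gcongr
          _ ≤ ((m : ℝ) + 1) ^ 2 * (m + 1) ^ 3 := by
              have : 7 / 5 * (1 / 2 ^ 1) ^ 2 * (m * (m / 2) * ((m : ℝ) - 1)) ≤ (m + 1) ^ 3 := by
                nlinarith [mul_nonneg hm0 hm0, mul_nonneg (mul_nonneg hm0 hm0) hm0]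
              calc _ = ((m : ℝ) + 1) ^ 2 *
                    (7 / 5 * (1 / 2 ^ 1) ^ 2 * (m * (m / 2) * ((m : ℝ) - 1))) := by ring
                _ ≤ _ := by gcongr
          _ = ((m : ℝ) + 1) ^ 5 := by ring
          _ ≤ _ := pow_le_pow_right₀ (by linarith) h5
  -- The tangent to the root at `m = 3` has slope `1/(2√3) < 0.289`, and `7/5 * 0.289 ≤ 81/200`.
  · have h1 : √(m : ℝ) ≤ 289 / 1000 * (m + 3) := by
      rw [Real.sqrt_le_left (by positivity)]
      nlinarith [sq_nonneg ((m : ℝ) - 3)]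
    obtain ⟨l, rfl⟩ : ∃ l, m = l + 3 := ⟨m - 3, by omega⟩
    have h2 := central_choose_bound l
    have h3 := choose_add_div_two_pow_le (l + 3) k
    have hk' : (2 : ℝ) ≤ k := by exact_mod_cast hk
    push_cast at hm3 hm0 h1 ⊢
    calc 7 / 5 * (((l + 3 + k).choose (l + 3) : ℝ) / 2 ^ k) ^ 2 *
          ((l + 3) * √(l + 3) * (l + 3 - 1))
        ≤ 7 / 5 * (((l + 3 + (l + 3)).choose (l + 3) : ℝ) / 2 ^ (l + 3)) ^ 2 *
          ((l + 3) * (289 / 1000 * (l + 3 + 3)) * (l + 3 - 1)) := by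
          have : (0 : ℝ) ≤ l + 3 - 1 := by linarith
          gcongr
      _ ≤ 81 / 200 * (((l + 3 + (l + 3)).choose (l + 3) : ℝ) / 2 ^ (l + 3)) ^ 2 *
          ((l + 3) * (l + 2) * (l + 6)) := by
          have : 0 ≤ (((l + 3 + (l + 3)).choose (l + 3) : ℝ) / 2 ^ (l + 3)) ^ 2 *
            (((l : ℝ) + 3) * (l + 2) * (l + 6)) := by positivity
          linarith
      _ ≤ ((l : ℝ) + 5) ^ (l + 3) := h2
      _ ≤ _ := pow_le_pow_left₀ (by positivity) (by linarith) _

/-- The square of the constant in the tail estimate. -/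
theorem sq_exp_half_eq {n m : ℕ} (hm : 3 ≤ m) (hmn : m ≤ n) :
    Real.exp (((m : ℝ) * Real.log n + 5 / 2 * Real.log m + Real.log 2) / 2) ^ 2 =
      2 * ((m : ℝ) ^ 2 * √m) * (n : ℝ) ^ m := by
  have hm0 : (0 : ℝ) < m := by exact_mod_cast (by omega : 0 < m)
  have hn0 : (0 : ℝ) < n := by exact_mod_cast (by omega : 0 < n)
  rw [← Real.exp_nat_mul]
  have h1 : √(m : ℝ) = Real.exp (1 / 2 * Real.log m) := by
    rw [Real.sqrt_eq_rpow, Real.rpow_def_of_pos hm0, mul_comm]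
  have h2 : (m : ℝ) ^ 2 = Real.exp (2 * Real.log m) := by
    rw [two_mul, Real.exp_add, Real.exp_log hm0, sq]
  have h3 : (n : ℝ) ^ m = Real.exp (m * Real.log n) := by
    rw [Real.exp_nat_mul, Real.exp_log hn0]
  have h4 : (2 : ℝ) = Real.exp (Real.log 2) := (Real.exp_log (by norm_num)).symm
  rw [h1, h2, h3]
  refine Eq.trans ?_ (congrArg (fun t => t * _ * _) h4.symm)
  rw [← Real.exp_add, ← Real.exp_add, ← Real.exp_add]
  congr 1
  push_cast
  ring

theorem sq_mul_sq_le_of_exp_mul_le_one {n m : ℕ} (hm : 3 ≤ m) (hmn : m ≤ n) {ε : ℝ} (hε : 0 < ε)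
    (hM : Real.exp (((m : ℝ) * Real.log n + 5 / 2 * Real.log m + Real.log 2) / 2) * ε ≤ 1) :
    ((m : ℝ) * ε) ^ 2 ≤ 1 / 91 := by
  have h1 := pow_le_pow_left₀ (by positivity) hM 2
  rw [mul_pow, sq_exp_half_eq hm hmn, one_pow] at h1
  have hm3 : (3 : ℝ) ≤ m := by exact_mod_cast hm
  have hn3 : (3 : ℝ) ≤ n := by exact_mod_cast hm.trans hmn
  have h2 : (17 / 10 : ℝ) ≤ √m := by
    rw [Real.le_sqrt' (by norm_num)]; linarith
  have h3 : (27 : ℝ) ≤ (n : ℝ) ^ m := by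
    calc (27 : ℝ) = 3 ^ 3 := by norm_num
      _ ≤ (n : ℝ) ^ 3 := by gcongr
      _ ≤ _ := pow_le_pow_right₀ (by linarith) hm
  have h4 : 17 / 10 * 27 ≤ √m * (n : ℝ) ^ m := mul_le_mul h2 h3 (by norm_num) (by positivity)
  have h5 : ((m : ℝ) * ε) ^ 2 * (17 / 10 * 27) ≤ ((m : ℝ) * ε) ^ 2 * (√m * (n : ℝ) ^ m) := by
    gcongr
  nlinarith

theorem sub_mul_bandBound_le {n m : ℕ} (hm : 3 ≤ m) (hmn : m ≤ n) {ε : ℝ} (hε : 0 < ε)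
    (hM : Real.exp (((m : ℝ) * Real.log n + 5 / 2 * Real.log m + Real.log 2) / 2) * ε ≤ 1) :
    ((n - m : ℕ) : ℝ) * bandBound m ε ≤ 1 / 16 := by
  have h0 := sq_mul_sq_le_of_exp_mul_le_one hm hmn hε hM
  have h1 := pow_le_pow_left₀ (by positivity) hM 2
  rw [mul_pow, sq_exp_half_eq hm hmn, one_pow] at h1
  have hm3 : (3 : ℝ) ≤ m := by exact_mod_cast hm
  have hn3 : (3 : ℝ) ≤ n := by exact_mod_cast hm.trans hmn
  have hmn' : (m : ℝ) ≤ n := by exact_mod_cast hmn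
  have h2 : (17 / 10 : ℝ) ≤ √m := by
    rw [Real.le_sqrt' (by norm_num)]; linarith
  have hε2 : ε ^ 2 ≤ 1 / 91 := by
    have : ε ^ 2 ≤ (m * ε) ^ 2 := by
      gcongr
      nlinarith
    linarith
  have hpos : 0 < 1 - ε ^ 2 := by linarith
  refine le_of_sq_le_sq ?_ (by norm_num)
  rw [Nat.cast_sub hmn, bandBound, mul_pow, mul_pow, mul_pow, div_pow, Real.sq_sqrt hpos.le,
    Real.sq_sqrt (by linarith : (0 : ℝ) ≤ m - 1),
    Real.sq_sqrt (by positivity : 0 ≤ 2 / Real.pi)]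
  have hpi := Real.pi_gt_d2
  -- Sharp at `n = 9`, `m = 3`: `4n³ - 81(n - 3)² = 4(n - 9)²(n - 9/4)`.
  have hn : ((n : ℝ) - m) ^ 2 * 81 ≤ 4 * (n : ℝ) ^ m := by
    calc ((n : ℝ) - m) ^ 2 * 81 ≤ ((n : ℝ) - 3) ^ 2 * 81 := by
          gcongr
      _ ≤ 4 * (n : ℝ) ^ 3 := by
          nlinarith [mul_nonneg (sq_nonneg ((n : ℝ) - 9)) (by linarith : (0 : ℝ) ≤ n - 9 / 4)]
      _ ≤ 4 * (n : ℝ) ^ m := by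
          gcongr
          linarith
  have h5 : (n : ℝ) ^ m * (ε ^ 2 * ((m : ℝ) - 1)) * (51 / 5) ≤ 1 := by
    have ha : (51 / 5) * ((m : ℝ) - 1) ≤ 2 * ((m : ℝ) ^ 2 * √m) := by
      have : (m : ℝ) ^ 2 * (17 / 10) ≤ m ^ 2 * √m := by gcongr
      nlinarith
    have := mul_le_mul_of_nonneg_right ha (by positivity : 0 ≤ (n : ℝ) ^ m * ε ^ 2)
    nlinarith
  have h6 : 2 / Real.pi ≤ 2 / (314 / 100) := by
    gcongr; linarith
  have h7 : ε ^ 2 / (1 - ε ^ 2) ≤ 91 / 90 * ε ^ 2 := by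
    rw [div_le_iff₀ hpos]
    nlinarith [sq_nonneg ε]
  calc ((n : ℝ) - m) ^ 2 * (2 / Real.pi * (ε ^ 2 / (1 - ε ^ 2)) * (m - 1))
      ≤ (4 / 81 * (n : ℝ) ^ m) * (2 / (314 / 100) * (91 / 90 * ε ^ 2) * (m - 1)) := by
        have : 0 ≤ (m : ℝ) - 1 := by linarith
        gcongr
        linarith
    _ = (4 / 81 * (2 / (314 / 100)) * (91 / 90)) * ((n : ℝ) ^ m * (ε ^ 2 * ((m : ℝ) - 1))) := by
        ring
    _ ≤ (1 / 16) ^ 2 := by linarith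

theorem tail_constant_le {n m : ℕ} (hm : 3 ≤ m) (hmn : m ≤ n) {ε : ℝ} (hε : 0 < ε)
    (hM : Real.exp (((m : ℝ) * Real.log n + 5 / 2 * Real.log m + Real.log 2) / 2) * ε ≤ 1) :
    n.choose m * (m * bandBound m (m * ε) *
        ((1 / 2 + bandBound m ε / 2) ^ (n - m) + (1 / 2) ^ (n - m))) ≤
      Real.exp (((m : ℝ) * Real.log n + 5 / 2 * Real.log m + Real.log 2) / 2) * ε := by
  have h0 := sq_mul_sq_le_of_exp_mul_le_one hm hmn hε hM
  have h1 := sub_mul_bandBound_le hm hmn hε hM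
  have h2 := choose_bound hm hmn
  have hm3 : (3 : ℝ) ≤ m := by exact_mod_cast hm
  have hm1 : 0 ≤ (m : ℝ) - 1 := by linarith
  have hb := bandBound_nonneg m hε.le
  set N := n - m
  set c := (n.choose m : ℝ) / 2 ^ N with hc
  set P := (1 + bandBound m ε) ^ N + 1 with hP
  have hP0 : 0 ≤ P := by positivity
  -- Here `(1 + bandBound m ε)^N ≤ exp(1/16) ≤ 16/15`, so the feasible and infeasible cases together
  -- cost little more than the factor 2.
  have hP1 : P ≤ 207 / 100 := by
    have : (1 + bandBound m ε) ^ N ≤ 16 / 15 := by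
      calc (1 + bandBound m ε) ^ N ≤ Real.exp (bandBound m ε) ^ N := by
            gcongr
            rw [add_comm]
            exact Real.add_one_le_exp _
        _ = Real.exp (N * bandBound m ε) := (Real.exp_nat_mul _ _).symm
        _ ≤ Real.exp (1 / 16) := Real.exp_le_exp.2 h1
        _ ≤ 16 / 15 := by
            have := Real.one_sub_le_exp_neg (1 / 16)
            rw [Real.exp_neg] at this
            have h3 := le_inv_of_le_inv₀ (by norm_num) this
            norm_num at h3 ⊢
            exact h3
    linarith
  set D := 1 - ((m : ℝ) * ε) ^ 2 with hD
  have hDpos : 90 / 91 ≤ D := by linarith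
  have hD0 : 0 < D := by linarith
  set Y := c * m ^ 2 * √(2 / Real.pi) * √((m : ℝ) - 1) / √D * P with hY
  have hLHS : n.choose m * (m * bandBound m (m * ε) *
        ((1 / 2 + bandBound m ε / 2) ^ N + (1 / 2) ^ N)) = Y * ε := by
    have e1 : (1 / 2 + bandBound m ε / 2) ^ N = (1 + bandBound m ε) ^ N / 2 ^ N := by
      rw [← div_pow]; congr 1; ring
    have e2 : bandBound m (m * ε) = √(2 / Real.pi) * (m * ε / √D) * √((m : ℝ) - 1) := rfl
    rw [e1, e2, one_div_pow, hY, hP, hc]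
    ring
  rw [hLHS]
  refine mul_le_mul_of_nonneg_right (le_of_sq_le_sq ?_ (Real.exp_pos _).le) hε.le
  rw [sq_exp_half_eq hm hmn, hY, mul_pow, div_pow, mul_pow, mul_pow, mul_pow, Real.sq_sqrt hD0.le,
    Real.sq_sqrt hm1, Real.sq_sqrt (by positivity)]
  have hpi := Real.pi_gt_d2
  calc c ^ 2 * ((m : ℝ) ^ 2) ^ 2 * (2 / Real.pi) * (m - 1) / D * P ^ 2
      ≤ c ^ 2 * ((m : ℝ) ^ 2) ^ 2 * (2 / (314 / 100)) * (m - 1) / (90 / 91) *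
          (207 / 100) ^ 2 := by
        gcongr
        linarith
    _ = (2 / (314 / 100) / (90 / 91) * (207 / 100) ^ 2) *
          (c ^ 2 * ((m : ℝ) ^ 2) ^ 2 * (m - 1)) := by ring
    -- `14/5` is twice the `7/5` of `choose_bound`; the 2 is the one in `exp(L/2)²`.
    _ ≤ 14 / 5 * (c ^ 2 * ((m : ℝ) ^ 2) ^ 2 * (m - 1)) := by
        gcongr
        norm_num
    _ = 2 * ((m : ℝ) ^ 2 * √m) * (7 / 5 * c ^ 2 * (m * √m * (m - 1))) := by
        have : √(m : ℝ) * √m = m := Real.mul_self_sqrt (by linarith)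
        linear_combination (-(14 / 5) * c ^ 2 * (m : ℝ) ^ 3 * (m - 1)) * this
    _ ≤ _ := by gcongr

end Numerics

/-! ### Moments from an exponential tail -/

section Moments

variable {Ω : Type*} [MeasurableSpace Ω] (P : Measure Ω)

/-- The layer-cake formula turns the tail bound into Euler's integral for `γ Γ(γ)`. -/
theorem lintegral_rpow_le_Gamma {W : Ω → ℝ} (hW : AEMeasurable W P) (hW0 : ∀ ω, 0 ≤ W ω)
    (htail : ∀ w : ℝ, 0 < w → P {ω | w < W ω} ≤ ENNReal.ofReal (Real.exp (-w)))
    {γ : ℝ} (hγ : 0 < γ) :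
    ∫⁻ ω, ENNReal.ofReal (W ω ^ γ) ∂P ≤ ENNReal.ofReal (Real.Gamma (γ + 1)) := by
  rw [lintegral_rpow_eq_lintegral_meas_lt_mul P (Filter.Eventually.of_forall hW0) hW hγ]
  calc _ ≤ ENNReal.ofReal γ *
        ∫⁻ t in Set.Ioi (0 : ℝ), ENNReal.ofReal (Real.exp (-t) * t ^ (γ - 1)) := by
        refine mul_le_mul' le_rfl ?_
        refine setLIntegral_mono' (measurableSet_Ioi (a := (0 : ℝ))) fun t ht => ?_
        rw [ENNReal.ofReal_mul (Real.exp_pos _).le]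
        gcongr
        exact htail t ht
    _ = _ := by
        rw [← ofReal_integral_eq_lintegral_ofReal (Real.GammaIntegral_convergent hγ)]
        · rw [← Real.Gamma_eq_integral hγ, ← ENNReal.ofReal_mul hγ.le, Real.Gamma_add_one hγ.ne']
        · filter_upwards [ae_restrict_mem measurableSet_Ioi] with t ht
          have : (0 : ℝ) < t := ht
          positivity

/-- Moments of a nonnegative random variable dominated by a shifted exponential variable. -/
theorem integrable_rpow_and_integral_rpow_le [IsProbabilityMeasure P] {Z : Ω → ℝ}
    (hZ : AEMeasurable Z P) (hZ0 : ∀ ω, 0 ≤ Z ω) {l : ℝ} (hl : 0 ≤ l)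
    (htail : ∀ w : ℝ, 0 < w → P {ω | l + w < Z ω} ≤ ENNReal.ofReal (Real.exp (-w)))
    {γ : ℝ} (hγ : 1 ≤ γ) :
    Integrable (fun ω => Z ω ^ γ) P ∧
      ∫ ω, Z ω ^ γ ∂P ≤ (2 * l) ^ γ + Real.Gamma (γ + 1) * (2 : ℝ) ^ (γ - 1) := by
  have hγ0 : 0 < γ := by linarith
  let W : Ω → ℝ := fun ω => max (Z ω - l) 0
  have hW : AEMeasurable W P := (hZ.sub_const l).max aemeasurable_const
  have hW0 : ∀ ω, 0 ≤ W ω := fun ω => le_max_right _ _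
  have hWγ0 : ∀ ω, 0 ≤ W ω ^ γ := fun ω => Real.rpow_nonneg (hW0 ω) γ
  have hlint := lintegral_rpow_le_Gamma P hW hW0 (fun w hw => by
    refine (measure_mono fun ω hω => ?_).trans (htail w hw)
    have h1 : w < max (Z ω - l) 0 := hω
    rcases lt_max_iff.1 h1 with h | h
    · rw [Set.mem_ofPred_eq]; linarith
    · linarith) hγ0
  have hWm : AEStronglyMeasurable (fun ω => W ω ^ γ) P := (hW.pow_const γ).aestronglyMeasurable
  have hWi : Integrable (fun ω => W ω ^ γ) P :=
    ⟨hWm, (hasFiniteIntegral_iff_ofReal (Filter.Eventually.of_forall hWγ0)).2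
      (hlint.trans_lt ENNReal.ofReal_lt_top)⟩
  have hWint : ∫ ω, W ω ^ γ ∂P ≤ Real.Gamma (γ + 1) := by
    rw [integral_eq_lintegral_of_nonneg_ae (Filter.Eventually.of_forall hWγ0) hWm]
    exact ENNReal.toReal_le_of_le_ofReal (Real.Gamma_pos_of_pos (by linarith)).le hlint
  have hle : ∀ ω, Z ω ^ γ ≤ 2 ^ (γ - 1) * (l ^ γ + W ω ^ γ) := fun ω => by
    have hconv : (l + W ω) ^ γ ≤ 2 ^ (γ - 1) * (l ^ γ + W ω ^ γ) := by
      exact_mod_cast NNReal.rpow_add_le_mul_rpow_add_rpow ⟨l, hl⟩ ⟨W ω, hW0 ω⟩ hγ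
    refine le_trans ?_ hconv
    refine Real.rpow_le_rpow (hZ0 ω) ?_ hγ0.le
    have : Z ω - l ≤ W ω := le_max_left _ _
    linarith
  have hdom : Integrable (fun ω => 2 ^ (γ - 1) * (l ^ γ + W ω ^ γ)) P :=
    ((integrable_const _).add hWi).const_mul _
  have hint : Integrable (fun ω => Z ω ^ γ) P := by
    refine hdom.mono' (hZ.pow_const γ).aestronglyMeasurable
      (Filter.Eventually.of_forall fun ω => ?_)
    rw [Real.norm_of_nonneg (Real.rpow_nonneg (hZ0 ω) γ)]
    exact hle ω
  refine ⟨hint, (integral_mono hint hdom hle).trans ?_⟩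
  rw [integral_const_mul, integral_add (integrable_const _) hWi, integral_const, probReal_univ,
    one_smul, mul_add]
  -- The convexity bound gives `2^(γ-1) l^γ`; it is relaxed to `(2l)^γ`, which is `L^γ` when `l =
  -- L/2`.
  have h2 : (2 : ℝ) ^ (γ - 1) ≤ 2 ^ γ :=
    Real.rpow_le_rpow_of_exponent_le (by norm_num) (by linarith)
  have h3 : (0 : ℝ) < 2 ^ (γ - 1) := by positivity
  have h4 : 0 ≤ l ^ γ := Real.rpow_nonneg hl γ
  rw [Real.mul_rpow (by norm_num) hl]
  have h5 := mul_le_mul_of_nonneg_left hWint h3.le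
  have h6 := mul_le_mul_of_nonneg_right h2 h4
  linarith

end Moments

/-! ### The logarithm of the condition number -/

section LogCondNumber

variable {n m : ℕ}

theorem measurable_theta_matrixOfRows [NeZero n] :
    Measurable fun a : Fin n → sphere (0 : EuclideanSpace ℝ (Fin m)) 1 =>
      theta (matrixOfRows a) := by
  refine LowerSemicontinuous.measurable ?_
  unfold theta
  refine lowerSemicontinuous_ciSup (fun a => bddAbove_range_thetaAt _) fun x => ?_
  refine Continuous.lowerSemicontinuous ?_
  unfold thetaAt
  simp_rw [← Finset.inf'_univ_eq_ciInf]
  refine Continuous.finset_inf'_apply Finset.univ_nonempty fun i _ => ?_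
  unfold InnerProductGeometry.angle
  simp_rw [rowVec_matrixOfRows, norm_eq_of_mem_sphere, one_mul]
  exact Real.continuous_arccos.comp (by fun_prop)

/-- Also valid when the cosine vanishes: `ENNReal.toReal ∞ = 0` and `Real.log 0 = 0` make both sides
0. -/
theorem logCondNumber_eq (A : Matrix (Fin n) (Fin m) ℝ) :
    logCondNumber A = -Real.log |Real.cos (theta A)| := by
  rw [logCondNumber, condNumber, ENNReal.toReal_inv, ENNReal.toReal_ofReal (abs_nonneg _),
    Real.log_inv]

theorem logCondNumber_nonneg (A : Matrix (Fin n) (Fin m) ℝ) : 0 ≤ logCondNumber A := by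
  rw [logCondNumber_eq]
  have := Real.log_nonpos (abs_nonneg _) (Real.abs_cos_le_one (theta A))
  linarith

theorem abs_cos_theta_lt_of_lt_logCondNumber {A : Matrix (Fin n) (Fin m) ℝ} {x : ℝ} (hx : 0 ≤ x)
    (h : x < logCondNumber A) : |Real.cos (theta A)| < Real.exp (-x) := by
  rw [logCondNumber_eq] at h
  rcases (abs_nonneg (Real.cos (theta A))).eq_or_lt with h0 | h0
  · rw [← h0, Real.log_zero] at h
    linarith
  · rw [← Real.log_lt_iff_lt_exp h0]
    linarith

theorem condNumber_lt_top_iff {A : Matrix (Fin n) (Fin m) ℝ} :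
    condNumber A < ∞ ↔ Real.cos (theta A) ≠ 0 := by
  rw [condNumber, ENNReal.inv_lt_top, ENNReal.ofReal_pos, abs_pos]

theorem measure_abs_cos_theta_lt_exp_le (hm : 3 ≤ m) (hmn : m ≤ n) {w : ℝ} (hw : 0 ≤ w) :
    Measure.pi (fun _ : Fin n => uniformSphere m)
      {a | |Real.cos (theta (matrixOfRows a))| <
        Real.exp (-(((m : ℝ) * Real.log n + 5 / 2 * Real.log m + Real.log 2) / 2 + w))} ≤
      ENNReal.ofReal (Real.exp (-w)) := by
  set l := ((m : ℝ) * Real.log n + 5 / 2 * Real.log m + Real.log 2) / 2 with hl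
  have hε : 0 < Real.exp (-(l + w)) := Real.exp_pos _
  have hMε : Real.exp l * Real.exp (-(l + w)) = Real.exp (-w) := by
    rw [← Real.exp_add]; congr 1; ring
  have hM : Real.exp l * Real.exp (-(l + w)) ≤ 1 := by
    rw [hMε]; exact Real.exp_le_one_iff.2 (by linarith)
  have h1 := sq_mul_sq_le_of_exp_mul_le_one hm hmn hε hM
  have h2 : m * Real.exp (-(l + w)) < 1 := by
    have : 0 ≤ m * Real.exp (-(l + w)) := by positivity
    nlinarith
  refine (measure_abs_cos_theta_lt_le (by omega) hmn hε h2).trans (ENNReal.ofReal_le_ofReal ?_)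
  exact (tail_constant_le hm hmn hε hM).trans_eq hMε

end LogCondNumber

theorem mainTheorem6 {Ω : Type*} [MeasurableSpace Ω] (P : Measure Ω) [IsProbabilityMeasure P]
    (n m : ℕ) (hm : 3 ≤ m) (hmn : m ≤ n)
    (A : Ω → Matrix (Fin n) (Fin m) ℝ) (hA : IsUniformRandomMatrix P A) :
    (∀ᵐ ω ∂P, condNumber (A ω) < ∞) ∧
    (∀ γ : ℝ, 1 ≤ γ →
      Integrable (fun ω => logCondNumber (A ω) ^ γ) P ∧
      ∫ ω, logCondNumber (A ω) ^ γ ∂P ≤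
        ((m : ℝ) * Real.log n + 5 / 2 * Real.log m + Real.log 2) ^ γ +
          Real.Gamma (γ + 1) * (2 : ℝ) ^ (γ - 1)) ∧
    (Integrable (fun ω => logCondNumber (A ω)) P ∧
      ∫ ω, logCondNumber (A ω) ∂P ≤
        (m : ℝ) * Real.log n + 5 / 2 * Real.log m + Real.log 2 + 1) ∧
    (MemLp (fun ω => logCondNumber (A ω)) 2 P ∧
      variance (fun ω => logCondNumber (A ω)) P ≤
        ((m : ℝ) * Real.log n + 5 / 2 * Real.log m + Real.log 2) ^ 2 + 4) := by
  obtain ⟨a, hlaw, hind, hAa⟩ := hA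
  have : NeZero n := ⟨by omega⟩
  set L := (m : ℝ) * Real.log n + 5 / 2 * Real.log m + Real.log 2 with hL
  have hL0 : 0 ≤ L := by
    have h1 := Real.log_natCast_nonneg n
    have h2 := Real.log_natCast_nonneg m
    have h3 := Real.log_nonneg (show (1 : ℝ) ≤ 2 by norm_num)
    positivity
  have hmeas : ∀ i, AEMeasurable (a i) P := fun i => (hlaw i).aemeasurable
  have hmeas' : AEMeasurable (fun ω i => a i ω) P := aemeasurable_pi_lambda _ hmeas
  have hmap : P.map (fun ω i => a i ω) = Measure.pi fun _ : Fin n => uniformSphere m := by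
    rw [(iIndepFun_iff_map_fun_eq_pi_map hmeas).1 hind]
    congr 1
    ext1 i
    exact (hlaw i).map_eq
  have hθ : AEMeasurable (fun ω => theta (A ω)) P := by
    simp_rw [hAa]
    exact measurable_theta_matrixOfRows.comp_aemeasurable hmeas'
  have htail : ∀ w : ℝ, 0 ≤ w → P {ω | |Real.cos (theta (A ω))| < Real.exp (-(L / 2 + w))} ≤
      ENNReal.ofReal (Real.exp (-w)) := by
    intro w hw
    have h := measure_abs_cos_theta_lt_exp_le hm hmn hw
    have hcos : Measurable fun a : Fin n → sphere (0 : EuclideanSpace ℝ (Fin m)) 1 =>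
        |Real.cos (theta (matrixOfRows a))| :=
      (Real.measurable_cos.comp measurable_theta_matrixOfRows).abs
    rw [← hmap, Measure.map_apply_of_aemeasurable hmeas'
      (measurableSet_lt hcos measurable_const)] at h
    simp_rw [hAa]
    exact h
  have hZ : AEMeasurable (fun ω => logCondNumber (A ω)) P := by
    simp_rw [logCondNumber_eq]
    exact (Real.measurable_log.comp_aemeasurable
      (Real.measurable_cos.comp_aemeasurable hθ).abs).neg
  have hmom : ∀ γ : ℝ, 1 ≤ γ → Integrable (fun ω => logCondNumber (A ω) ^ γ) P ∧
      ∫ ω, logCondNumber (A ω) ^ γ ∂P ≤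
        L ^ γ + Real.Gamma (γ + 1) * (2 : ℝ) ^ (γ - 1) := by
    intro γ hγ
    have h := integrable_rpow_and_integral_rpow_le P hZ (fun ω => logCondNumber_nonneg _)
      (l := L / 2) (by positivity) (fun w hw => (measure_mono fun ω hω =>
        abs_cos_theta_lt_of_lt_logCondNumber (by positivity) hω).trans (htail w hw.le)) hγ
    rwa [mul_div_cancel₀ L two_ne_zero] at h
  refine ⟨?_, hmom, ?_, ?_⟩
  · simp_rw [condNumber_lt_top_iff]
    rw [ae_iff]
    -- The event `cos θ(A) = 0` lies in every tail event, whose probabilities tend to 0.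
    have hlim : Filter.Tendsto (fun w : ℝ => ENNReal.ofReal (Real.exp (-w))) Filter.atTop
        (nhds 0) := by
      have := ENNReal.tendsto_ofReal (Real.tendsto_exp_neg_atTop_nhds_zero)
      rwa [ENNReal.ofReal_zero] at this
    refine le_antisymm (ge_of_tendsto hlim ?_) zero_le
    filter_upwards [Filter.eventually_ge_atTop 0] with w hw
    refine (measure_mono fun ω hω => ?_).trans (htail w hw)
    have h0 : Real.cos (theta (A ω)) = 0 := not_not.1 hω
    rw [Set.mem_ofPred_eq, h0, abs_zero]
    exact Real.exp_pos _
  · have h := hmom 1 le_rfl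
    simp only [Real.rpow_one, sub_self, Real.rpow_zero, mul_one] at h
    rwa [one_add_one_eq_two, Real.Gamma_two] at h
  · have h := hmom 2 (by norm_num)
    have hG : Real.Gamma (2 + 1) = 2 := by
      have := Real.Gamma_nat_eq_factorial 2
      norm_num at this ⊢
    rw [hG] at h
    norm_num at h
    refine ⟨(memLp_two_iff_integrable_sq hZ.aestronglyMeasurable).2 h.1, ?_⟩
    -- The variance is bounded by the second moment, and `Γ(3) * 2 = 4`.
    exact (variance_le_expectation_sq hZ.aestronglyMeasurable).trans h.2
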